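/- Throughout, $\log$ is the logarithm to base $2$. A $k$-CNF formula $\Phi$ has variables $\mathcal V=\{v_1,\dots,v_n\}$ and clauses $\mathcal C=\{C_1,\dots,C_m\}$, each clause being a disjunction of $k$ literals (repetitions allowed); $\mathsf{vbl}(C)$ is the set of variables occurring in $C$, $\mathsf{vbl}(\mathcal C')=\bigcup_{C\in\mathcal C'}\mathsf{vbl}(C)$, and $\deg(v)=|\{C: v\in\mathsf{vbl}(C)\}|$. In $G_\Phi$ two clauses are adjacent iff they share a variable; in $H_\Phi$ two variables are adjacent iff they lie in a common clause. Put $\alpha=m/n$, $\eta=15\log(k)/k$, $D=k^8(\alpha+1)/\xi$ and $\delta=\xi/(k^{40}\alpha)$. **Nice instances** (with absolute constant $c$): $k\ge 2^{20}$, $n\ge 2^{ck}$, $2^{-k/8}\le\xi\le1$, $1/k^3\le\alpha\le\xi 2^{k/3}/k^{50}$, $\Phi$ is satisfiable, and (1) $|\mathsf{vbl}(C)|\ge k-2$ for all $C$; (2) $|\{C:\mathsf{vbl}(C)\subseteq\mathcal V'\}|\le(1+\eta)|\mathcal V'|/k$ whenever $1\le|\mathcal V'|\le n/2^{k/\log k}$;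 (3) $|\mathsf{vbl}(\mathcal C')|\ge k|\mathcal C'|/(1+\eta)$ whenever $1\le|\mathcal C'|\le n/2^{2k/\log k}$; (4) $|\mathcal V'|\ge(b-\eta)k\cdot|\{C:|\mathsf{vbl}(C)\cap\mathcal V'|\ge bk\}|$ for all $b\ge\eta$ and $1\le|\mathcal V'|\le n/2^{3k/\log k}$; (5) for every $C$ and $\ell\ge1$, at most $\alpha^2n^4(\mathbf e k^2\alpha)^\ell$ sets of $\ell$ clauses containing $C$ are connected in $G_\Phi$; (6) $\deg(v)\le 4k\alpha+6\log n$ for all $v$; (7) $|\{v:\deg(v)\ge D\}|\le n/2^{4k}$; (8) if $|\mathcal C'|\le n/2^{4k}$ and $C_{i_1},\dots,C_{i_\ell}\notin\mathcal C'$ are distinct with $|\mathsf{vbl}(C_{i_t})\cap\mathsf{vbl}(\mathcal C'\cup\{C_{i_1},\dots,C_{i_{t-1}}\})|\ge6$ for all $t$, then $\ell\le|\mathcal C'|$; (9) for every $\mathcal V'$ connected in $H_\Phi$, the set of vertices in or adjacent to $\mathcal V'$ has size at most $3k^4\alpha\max\{|\mathcal V'|,\lfloor k\log n\rfloor\}$;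 (10) for every $\mathcal V'$ connected in $H_\Phi$ with $|\mathcal V'|\ge\log n$, $|\{v\in\mathcal V':\deg(v)\ge D\}|\le|\mathcal V'|/k^2$. **Separators.** Start with $\mathcal V_{\mathsf{sep}}=\{v:\deg(v)\ge D\}$, $\mathcal C_{\mathsf{sep}}=\emptyset$; while some $C\notin\mathcal C_{\mathsf{sep}}$ has $|\mathsf{vbl}(C)\cap\mathcal V_{\mathsf{sep}}|\ge2\eta k$, add $C$ to $\mathcal C_{\mathsf{sep}}$ and $\mathsf{vbl}(C)$ to $\mathcal V_{\mathsf{sep}}$. **Partial assignments** are $\sigma\in\{0,1,\bigstar,\text{☆}\}^{\mathcal V}$ (★: accessed but unassigned; ☆: unaccessed). $\Lambda(\sigma)$ is the set of $v$ with $\sigma(v)\in\{\bigstar,\text{☆}\}$; $C$ is *satisfied* by $\sigma$ if a literal of $C$ is true under the assigned bits. $\Phi^\sigma$ is the restricted formula on $\Lambda(\sigma)$, whose clauses are the clauses not satisfied by $\sigma$, two of them being linked if they share a variable of $\Lambda(\sigma)$; $\mu^\sigma$ is the uniform distribution on its solutions and $\mu^\sigma_v$ its marginal at $v$. Define: - $v\in\mathcal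 V^\sigma_{\mathsf{alive}}$ iff $\sigma(v)=\text{☆}$, $v\notin\mathcal V_{\mathsf{sep}}$, and every $C\notin\mathcal C_{\mathsf{sep}}$ is satisfied by $\sigma$ or has $|\mathsf{vbl}(C)\cap\Lambda(\sigma)\setminus(\mathcal V_{\mathsf{sep}}\cup\{v\})|\ge(2/3-2\eta)k$; - $C\in\mathcal C^\sigma_{\mathsf{frozen}}$ iff $C$ is not satisfied by $\sigma$, $C\notin\mathcal C_{\mathsf{sep}}$, and $|\mathsf{vbl}(C)\cap\Lambda(\sigma)\setminus\mathcal V_{\mathsf{sep}}|<1+(2/3-2\eta)k$; - $C\in\mathcal C^\sigma_{\mathsf{bad}}$ iff $C$ is not satisfied by $\sigma$, $C\notin\mathcal C^\sigma_{\mathsf{frozen}}\cup\mathcal C_{\mathsf{sep}}$, and every $v\in\mathsf{vbl}(C)\setminus\mathcal V_{\mathsf{sep}}$ with $\sigma(v)=\text{☆}$ lies in a clause of $\mathcal C^\sigma_{\mathsf{frozen}}$; - for $\sigma(v)=\bigstar$, $\mathcal C^\sigma_{\mathsf{int}}(v)$ is the smallest set containing every $C\in\mathcal C^\sigma_{\mathsf{frozen}}\cup\mathcal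 C^\sigma_{\mathsf{bad}}\cup\mathcal C_{\mathsf{sep}}$ with $v\in\mathsf{vbl}(C)$, or with $\mathsf{vbl}(C')\cap\mathsf{vbl}(C)\cap\Lambda(\sigma)\ne\emptyset$ for some $C'\in\mathcal C^\sigma_{\mathsf{int}}(v)$; - $\mathcal C^\sigma_{\mathsf{con}}(v)$ consists of $\mathcal C^\sigma_{\mathsf{int}}(v)$, all $C\ni v$, and all $C$ sharing a variable of $\Lambda(\sigma)$ with a clause of $\mathcal C^\sigma_{\mathsf{int}}(v)$; $\mathcal C^\sigma_{\mathsf{con}}=\bigcup_{v:\sigma(v)=\bigstar}\mathcal C^\sigma_{\mathsf{con}}(v)$; - $\mathsf{NextVar}(\sigma)$ is the variable of least index in $\mathcal V^\sigma_{\mathsf{alive}}\cap\mathsf{vbl}(\mathcal C^\sigma_{\mathsf{con}})$, or $\bot$ if there is none. **Algorithm.** Let $\tau$ take the values $0,1,\bigstar$ with probabilities $\frac{1-\delta}2,\frac{1-\delta}2,\delta$, and let $\nu^\sigma_v(b)=(\mu^\sigma_v(b)-\frac{1-\delta}2)/\delta$. - $\mathsf{SolutionSampling}(\Phi,s)$: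 start with $\sigma\equiv\text{☆}$; for $i=1,\dots,n$, if $v_i\in\mathcal V^\sigma_{\mathsf{alive}}$, set $\sigma(v_i)\leftarrow\mathsf{MarginSample}(\sigma,v_i,s)$. Then halt if some connected component of $\Phi^\sigma$ has more than $s$ clauses; otherwise output a uniform solution of $\Phi^\sigma$ (by rejection sampling) together with $\sigma$. - $\mathsf{MarginSample}(\sigma,v,s)$: sample $\sigma(v)\sim\tau$; if it is a bit return it, otherwise return $\mathsf{MarginOverflow}(\sigma,v,s)$. - $\mathsf{MarginOverflow}(\sigma,v,s)$: halt if $|\mathcal C^\sigma_{\mathsf{con}}|>s$. Let $u=\mathsf{NextVar}(\sigma)$. If $u=\bot$, return a bit with law $\nu^\sigma_v$ (by a Bernoulli factory). Otherwise sample $\sigma(u)\sim\tau$; if $\sigma(u)=\bigstar$ set $\sigma(u)\leftarrow\mathsf{MarginOverflow}(\sigma,u,s)$; return $\mathsf{MarginOverflow}(\sigma,v,s)$. Arguments are passed by value, and halting inside a call halts the whole algorithm. Let $p_{\mathsf{halt}}(\Phi,s)$ be the probability that the algorithm halts in one of these two ways (truncation). **Depth.** For a partial assignment $\sigma$ let $\mathcal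 T_\sigma$ be the rooted tree with root $\sigma$ in which a node $\pi$ is a leaf if $|\mathcal C^\pi_{\mathsf{con}}|>s$ or $\mathsf{NextVar}(\pi)=\bot$, and otherwise has three children, obtained by changing $\pi(\mathsf{NextVar}(\pi))$ to $0,1,\bigstar$. In the simulation tree the root is $\text{☆}^{\mathcal V}$; a node $\pi$ without $\bigstar$ and with $\mathcal V^\pi_{\mathsf{alive}}\ne\emptyset$ has three children, obtained by changing the value at the least-index variable of $\mathcal V^\pi_{\mathsf{alive}}$ to $0,1,\bigstar$; the children so obtained that have a $\bigstar$ are the recursing nodes, at which $\mathcal T_\pi$ is attached. Let $d_{\mathsf{rec}}$ be the maximal depth of $\mathcal T_\sigma$ over all recursing nodes $\sigma$ (and $0$ if there are none). **Lemma.** There is an absolute constant $c>0$ such that, for every nice instance (with this $c$) and every real $s$ with $$6k^4\alpha\log n<s\le n/2^{5k/\log k},$$ $$p_{\mathsf{halt}}(\Phi,s)\le n^{10}(1+\delta)^{d_{\mathsf{rec}}+1}\cdot k^{-s/(6k^4\alpha)}.$$ -/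

import Mathlib

noncomputable section

namespace RandomKSat

open scoped Classical

/-! ### Formulas, clauses, incidence graphs -/

/-- A `k`-CNF formula with `n` variables and `m` clauses: every clause is a disjunction of `k`
literals, repetitions allowed. The literal `(v, true)` is `v` and `(v, false)` is `¬ v`. -/
abbrev KCNF (k n m : ℕ) : Type := Fin m → Fin k → Fin n × Bool

variable {k n m : ℕ}

/-- The set of variables of a clause. -/
def vbl (Φ : KCNF k n m) (C : Fin m) : Finset (Fin n) :=
  Finset.univ.image fun j => (Φ C j).1

/-- The set of variables of a set of clauses. -/
def vblSet (Φ : KCNF k n m) (S : Finset (Fin m)) : Finset (Fin n) :=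
  S.biUnion (vbl Φ)

/-- The (total) assignment `x` is a solution of `Φ`. -/
def IsSolution (Φ : KCNF k n m) (x : Fin n → Bool) : Prop :=
  ∀ C, ∃ j, x (Φ C j).1 = (Φ C j).2

/-- The number of clauses containing `v`. -/
def degree (Φ : KCNF k n m) (v : Fin n) : ℕ :=
  (Finset.univ.filter fun C => v ∈ vbl Φ C).card

/-- The incidence graph on clauses: distinct clauses are adjacent if they share a variable. -/
def clauseGraph (Φ : KCNF k n m) : SimpleGraph (Fin m) :=
  SimpleGraph.fromRel fun C C' => (vbl Φ C ∩ vbl Φ C').Nonempty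

/-- The incidence graph on variables: distinct variables are adjacent if they lie in a common
clause. -/
def variableGraph (Φ : KCNF k n m) : SimpleGraph (Fin n) :=
  SimpleGraph.fromRel fun v w => ∃ C, v ∈ vbl Φ C ∧ w ∈ vbl Φ C

/-! ### Parameters (`log` is the logarithm to base two) -/

/-- The density `α = m / n`. -/
def density (_Φ : KCNF k n m) : ℝ := (m : ℝ) / n

/-- `η = 15 log k / k`. -/
def eta (_Φ : KCNF k n m) : ℝ := 15 * Real.logb 2 k / k

/-- `D = k ^ 8 (α + 1) / ξ`. -/
def highDeg (Φ : KCNF k n m) (ξ : ℝ) : ℝ := (k : ℝ) ^ 8 * (density Φ + 1) / ξ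

/-- `δ = ξ / (k ^ 40 α)`. -/
def delta (Φ : KCNF k n m) (ξ : ℝ) : ℝ := ξ / ((k : ℝ) ^ 40 * density Φ)

/-! ### Good and nice instances -/

/-- Every clause has at least `k - 2` distinct variables. -/
def WidthProp (Φ : KCNF k n m) : Prop :=
  ∀ C, (k : ℝ) - 2 ≤ (vbl Φ C).card

/-- Few clauses live inside a small set of variables. -/
def ClausesInsideProp (Φ : KCNF k n m) : Prop :=
  ∀ V : Finset (Fin n), 1 ≤ V.card →
    (V.card : ℝ) ≤ n / (2 : ℝ) ^ ((k : ℝ) / Real.logb 2 k) →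
    ((Finset.univ.filter fun C => vbl Φ C ⊆ V).card : ℝ) ≤ (1 + eta Φ) * V.card / k

/-- A small set of clauses covers many variables. -/
def DistinctVarsProp (Φ : KCNF k n m) : Prop :=
  ∀ S : Finset (Fin m), 1 ≤ S.card →
    (S.card : ℝ) ≤ n / (2 : ℝ) ^ (2 * (k : ℝ) / Real.logb 2 k) →
    (k : ℝ) * S.card / (1 + eta Φ) ≤ (vblSet Φ S).card

/-- Few clauses share at least `b k` variables with a small set of variables. -/
def HeavyIntersectionProp (Φ : KCNF k n m) : Prop :=
  ∀ b : ℝ, eta Φ ≤ b → ∀ V : Finset (Fin n), 1 ≤ V.card →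
    (V.card : ℝ) ≤ n / (2 : ℝ) ^ (3 * (k : ℝ) / Real.logb 2 k) →
    (b - eta Φ) * k *
      (Finset.univ.filter fun C => b * (k : ℝ) ≤ ((vbl Φ C ∩ V).card : ℝ)).card ≤ (V.card : ℝ)

/-- Bound on the number of connected sets of `l` clauses containing a given clause. -/
def ConnectedCountProp (Φ : KCNF k n m) : Prop :=
  ∀ (C : Fin m) (l : ℕ), 1 ≤ l →
    ((Finset.univ.filter fun S : Finset (Fin m) =>
      C ∈ S ∧ S.card = l ∧ ((clauseGraph Φ).induce (S : Set (Fin m))).Connected).card : ℝ) ≤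
      density Φ ^ 2 * (n : ℝ) ^ 4 * (Real.exp 1 * (k : ℝ) ^ 2 * density Φ) ^ l

/-- Bound on the maximum degree of a variable. -/
def MaxDegreeProp (Φ : KCNF k n m) : Prop :=
  ∀ v, (degree Φ v : ℝ) ≤ 4 * k * density Φ + 6 * Real.logb 2 n

/-- There are few variables of degree at least `D`. -/
def FewHighDegreeProp (Φ : KCNF k n m) (ξ : ℝ) : Prop :=
  ((Finset.univ.filter fun v => highDeg Φ ξ ≤ (degree Φ v : ℝ)).card : ℝ) ≤
    n / (2 : ℝ) ^ (4 * k)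

/-- Peeling: if distinct clauses `i 0, …, i (l-1)` outside a small `S` each share at least six
variables with `S` and the preceding ones, then there are at most `|S|` of them. -/
def PeelingProp (Φ : KCNF k n m) : Prop :=
  ∀ S : Finset (Fin m), (S.card : ℝ) ≤ n / (2 : ℝ) ^ (4 * k) →
    ∀ (l : ℕ) (i : Fin l → Fin m), Function.Injective i → (∀ t, i t ∉ S) →
      (∀ t, 6 ≤ (vbl Φ (i t) ∩
        (vblSet Φ S ∪ vblSet Φ ((Finset.univ.filter fun r => r < t).image i))).card) →
      l ≤ S.card

/-- Bound on the closed neighbourhood of a connected set of variables. -/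
def NeighborsProp (Φ : KCNF k n m) : Prop :=
  ∀ V : Finset (Fin n), ((variableGraph Φ).induce (V : Set (Fin n))).Connected →
    ((Finset.univ.filter fun v => v ∈ V ∨ ∃ u ∈ V, (variableGraph Φ).Adj v u).card : ℝ) ≤
      3 * (k : ℝ) ^ 4 * density Φ * max (V.card : ℝ) (⌊(k : ℝ) * Real.logb 2 n⌋₊ : ℝ)

/-- Bound on the fraction of variables of degree at least `D` in a large connected set. -/
def HighDegreeFractionProp (Φ : KCNF k n m) (ξ : ℝ) : Prop :=
  ∀ V : Finset (Fin n), ((variableGraph Φ).induce (V : Set (Fin n))).Connected →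
    Real.logb 2 n ≤ (V.card : ℝ) →
    ((V.filter fun v => highDeg Φ ξ ≤ (degree Φ v : ℝ)).card : ℝ) ≤ V.card / (k : ℝ) ^ 2

/-- Good instances; `c` is the absolute constant in the requirement `n ≥ 2 ^ Ω(k)`. -/
structure IsGood (c : ℝ) (Φ : KCNF k n m) (ξ : ℝ) : Prop where
  k_large : 2 ^ 20 ≤ k
  n_large : (2 : ℝ) ^ (c * (k : ℝ)) ≤ n
  xi_lower : (2 : ℝ) ^ (-(k : ℝ) / 8) ≤ ξ
  xi_upper : ξ ≤ 1
  density_upper : density Φ ≤ ξ * (2 : ℝ) ^ ((k : ℝ) / 3) / (k : ℝ) ^ 50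
  satisfiable : ∃ x, IsSolution Φ x
  width : WidthProp Φ
  clauses_inside : ClausesInsideProp Φ
  distinct_vars : DistinctVarsProp Φ
  heavy_intersection : HeavyIntersectionProp Φ
  connected_count : ConnectedCountProp Φ
  max_degree : MaxDegreeProp Φ
  few_high_degree : FewHighDegreeProp Φ ξ
  peeling : PeelingProp Φ

/-- Nice instances. -/
structure IsNice (c : ℝ) (Φ : KCNF k n m) (ξ : ℝ) : Prop extends IsGood c Φ ξ where
  density_lower : 1 / (k : ℝ) ^ 3 ≤ density Φ
  neighbors : NeighborsProp Φ
  high_degree_fraction : HighDegreeFractionProp Φ ξ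

/-! ### Separators -/

/-- Clauses that the separator construction can still add. -/
def sepEligible (Φ : KCNF k n m) (p : Finset (Fin n) × Finset (Fin m)) : Finset (Fin m) :=
  Finset.univ.filter fun C => C ∉ p.2 ∧ 2 * eta Φ * k ≤ ((vbl Φ C ∩ p.1).card : ℝ)

/-- One iteration of the while-loop: add the eligible clause of smallest index, if there is one
(the final result does not depend on the choice). -/
def sepStep (Φ : KCNF k n m) (p : Finset (Fin n) × Finset (Fin m)) :
    Finset (Fin n) × Finset (Fin m) :=
  if h : (sepEligible Φ p).Nonempty then
    (p.1 ∪ vbl Φ ((sepEligible Φ p).min' h), insert ((sepEligible Φ p).min' h) p.2)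
  else p

/-- The output of the separator construction started from all variables of degree at least `D`.
Every effective iteration adds a new clause, so `m` iterations exhaust the loop. -/
def constructSep (Φ : KCNF k n m) (ξ : ℝ) : Finset (Fin n) × Finset (Fin m) :=
  (sepStep Φ)^[m] (Finset.univ.filter fun v => highDeg Φ ξ ≤ (degree Φ v : ℝ), ∅)

/-- Variable separators. -/
def Vsep (Φ : KCNF k n m) (ξ : ℝ) : Finset (Fin n) := (constructSep Φ ξ).1

/-- Clause separators. -/
def Csep (Φ : KCNF k n m) (ξ : ℝ) : Finset (Fin m) := (constructSep Φ ξ).2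

/-! ### Partial assignments -/

/-- The status of a variable: fixed to a bit, accessed but unassigned (the black star), or
unaccessed (the white star). -/
inductive Status : Type
  | bit (b : Bool)
  | star
  | unaccessed

/-- Partial assignments. -/
abbrev PAssign (n : ℕ) : Type := Fin n → Status

/-- The set `Λ(σ)` of unassigned variables. -/
def unassigned (σ : PAssign n) : Finset (Fin n) :=
  Finset.univ.filter fun v => σ v = Status.star ∨ σ v = Status.unaccessed

/-- The variables already fixed by `σ` satisfy the clause `C`. -/
def SatBy (Φ : KCNF k n m) (σ : PAssign n) (C : Fin m) : Prop :=
  ∃ j, σ (Φ C j).1 = Status.bit (Φ C j).2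

/-- The solutions of the restricted formula `Φ^σ`, written as total assignments that
extend `σ`. -/
def completions (Φ : KCNF k n m) (σ : PAssign n) : Finset (Fin n → Bool) :=
  Finset.univ.filter fun x => IsSolution Φ x ∧ ∀ v b, σ v = Status.bit b → x v = b

/-- The marginal probability `μ_v^σ(b)` under the uniform distribution on the solutions of
`Φ^σ`. -/
def marginal (Φ : KCNF k n m) (σ : PAssign n) (v : Fin n) (b : Bool) : ℝ :=
  (((completions Φ σ).filter fun x => x v = b).card : ℝ) / (completions Φ σ).card

/-- The graph of `Φ^σ`: its vertices are the clauses not satisfied by `σ`, two of them being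
adjacent if they share an unassigned variable. -/
def residualGraph (Φ : KCNF k n m) (σ : PAssign n) : SimpleGraph {C : Fin m // ¬ SatBy Φ σ C} :=
  SimpleGraph.fromRel fun C C' => (vbl Φ C.1 ∩ vbl Φ C'.1 ∩ unassigned σ).Nonempty

/-- Some connected component of `Φ^σ` has more than `s` clauses. -/
def HasLargeComponent (Φ : KCNF k n m) (s : ℝ) (σ : PAssign n) : Prop :=
  ∃ K : (residualGraph Φ σ).ConnectedComponent, s < (K.supp.ncard : ℝ)

/-- The alive variables. -/
def alive (Φ : KCNF k n m) (ξ : ℝ) (σ : PAssign n) : Finset (Fin n) :=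
  Finset.univ.filter fun v => σ v = Status.unaccessed ∧ v ∉ Vsep Φ ξ ∧
    ∀ C, C ∉ Csep Φ ξ → SatBy Φ σ C ∨
      (2 / 3 - 2 * eta Φ) * k ≤
        (((vbl Φ C ∩ unassigned σ) \ (Vsep Φ ξ ∪ {v})).card : ℝ)

/-- The frozen clauses. -/
def frozen (Φ : KCNF k n m) (ξ : ℝ) (σ : PAssign n) : Finset (Fin m) :=
  Finset.univ.filter fun C => ¬ SatBy Φ σ C ∧ C ∉ Csep Φ ξ ∧
    (((vbl Φ C ∩ unassigned σ) \ Vsep Φ ξ).card : ℝ) < 1 + (2 / 3 - 2 * eta Φ) * k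

/-- The bad clauses. -/
def bad (Φ : KCNF k n m) (ξ : ℝ) (σ : PAssign n) : Finset (Fin m) :=
  Finset.univ.filter fun C => ¬ SatBy Φ σ C ∧ C ∉ frozen Φ ξ σ ∪ Csep Φ ξ ∧
    ∀ v ∈ vbl Φ C \ Vsep Φ ξ, σ v = Status.unaccessed → ∃ C' ∈ frozen Φ ξ σ, v ∈ vbl Φ C'

/-- Membership in the bad interior of `v`. -/
inductive InInt (Φ : KCNF k n m) (ξ : ℝ) (σ : PAssign n) (v : Fin n) : Fin m → Prop
  | base (C : Fin m) : C ∈ frozen Φ ξ σ ∪ bad Φ ξ σ ∪ Csep Φ ξ → v ∈ vbl Φ C →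
      InInt Φ ξ σ v C
  | step (C' C : Fin m) : InInt Φ ξ σ v C' → C ∈ frozen Φ ξ σ ∪ bad Φ ξ σ ∪ Csep Φ ξ →
      (vbl Φ C' ∩ vbl Φ C ∩ unassigned σ).Nonempty → InInt Φ ξ σ v C

/-- Membership in the current component of `v`. -/
def InCon (Φ : KCNF k n m) (ξ : ℝ) (σ : PAssign n) (v : Fin n) (C : Fin m) : Prop :=
  InInt Φ ξ σ v C ∨ v ∈ vbl Φ C ∨
    ∃ C', InInt Φ ξ σ v C' ∧ (vbl Φ C' ∩ vbl Φ C ∩ unassigned σ).Nonempty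

/-- The union of the current components of all starred variables. -/
def Ccon (Φ : KCNF k n m) (ξ : ℝ) (σ : PAssign n) : Finset (Fin m) :=
  Finset.univ.filter fun C => ∃ v, σ v = Status.star ∧ InCon Φ ξ σ v C

/-- The element of smallest index of a set of variables, if there is one. -/
def leastVar (S : Finset (Fin n)) : Option (Fin n) :=
  if h : S.Nonempty then some (S.min' h) else none

/-- The next variable to be sampled inside the overflow procedure. -/
def nextVar (Φ : KCNF k n m) (ξ : ℝ) (σ : PAssign n) : Option (Fin n) :=
  leastVar (alive Φ ξ σ ∩ vblSet Φ (Ccon Φ ξ σ))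

/-! ### The sampling algorithm -/

/-- Truncation of a real number to `[0, 1]`; it only serves to make the probability
distributions below total functions of their parameters. -/
def clampUnit (x : ℝ) : NNReal := min x.toNNReal 1

theorem clampUnit_le_one (x : ℝ) : clampUnit x ≤ 1 := min_le_right _ _

/-- The Bernoulli distribution with parameter `x` (truncated to `[0, 1]`). -/
def bern (x : ℝ) : PMF Bool :=
  PMF.ofFintype (fun b => if b then (clampUnit x : ENNReal) else 1 - (clampUnit x : ENNReal)) (by
    simpa using add_tsub_cancel_of_le
      (ENNReal.coe_le_coe.2 (clampUnit_le_one x) : (clampUnit x : ENNReal) ≤ 1))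

/-- The distribution `τ`: the star with probability `δ`, and each bit with
probability `(1 - δ) / 2`. -/
def tau (Φ : KCNF k n m) (ξ : ℝ) : PMF (Option Bool) :=
  (bern (delta Φ ξ)).bind fun isStar =>
    if isStar then PMF.pure none else (PMF.uniformOfFintype Bool).map some

/-- `ν_v^σ(b) = (μ_v^σ(b) - (1 - δ) / 2) / δ`. -/
def nu (Φ : KCNF k n m) (ξ : ℝ) (σ : PAssign n) (v : Fin n) (b : Bool) : ℝ :=
  (marginal Φ σ v b - (1 - delta Φ ξ) / 2) / delta Φ ξ

/-- The law of the bit returned by the Bernoulli factory, which is fed with independent samples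
of `μ_v^σ`: it is `ν_v^σ`. -/
def bernoulliFactory (Φ : KCNF k n m) (ξ : ℝ) (σ : PAssign n) (v : Fin n) : PMF Bool :=
  bern (nu Φ ξ σ v true)

/-- The number of unaccessed variables. -/
def numUnaccessed (σ : PAssign n) : ℕ :=
  (Finset.univ.filter fun v => σ v = Status.unaccessed).card

theorem numUnaccessed_update_lt {σ : PAssign n} {u : Fin n} (hu : σ u = Status.unaccessed)
    {a : Status} (ha : a ≠ Status.unaccessed) :
    numUnaccessed (Function.update σ u a) < numUnaccessed σ := by
  refine Finset.card_lt_card ⟨fun v hv => ?_, fun h => ?_⟩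
  · simp only [Finset.mem_filter, Finset.mem_univ, true_and] at hv ⊢
    by_cases hvu : v = u
    · rw [hvu]; exact hu
    · rwa [Function.update_of_ne hvu] at hv
  · have := h (by simpa using hu : u ∈ Finset.univ.filter fun v => σ v = Status.unaccessed)
    simp only [Finset.mem_filter, Finset.mem_univ, true_and, Function.update_self] at this
    exact ha this

theorem nextVar_unaccessed {Φ : KCNF k n m} {ξ : ℝ} {σ : PAssign n} {u : Fin n}
    (h : nextVar Φ ξ σ = some u) : σ u = Status.unaccessed := by
  unfold nextVar leastVar at h
  split at h
  · rename_i hne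
    have hmem := Finset.min'_mem _ hne
    rw [Option.some.inj h] at hmem
    exact (Finset.mem_filter.1 (Finset.mem_inter.1 hmem).1).2.1
  · cases h

/-- The overflow procedure with truncation parameter `s`, as the law of its result: `none` means
that it halted because of a truncation, `some b` that it returned the bit `b`. -/
def marginOverflow (Φ : KCNF k n m) (ξ s : ℝ) (σ : PAssign n) (v : Fin n) :
    PMF (Option Bool) :=
  if s < ((Ccon Φ ξ σ).card : ℝ) then PMF.pure none
  else
    match _h : nextVar Φ ξ σ with
    | none => (bernoulliFactory Φ ξ σ v).map some
    | some u =>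
      (tau Φ ξ).bind fun a =>
        match a with
        | some b => marginOverflow Φ ξ s (Function.update σ u (Status.bit b)) v
        | none =>
          (marginOverflow Φ ξ s (Function.update σ u Status.star) u).bind fun r =>
            match r with
            | none => PMF.pure none
            | some b => marginOverflow Φ ξ s (Function.update σ u (Status.bit b)) v
termination_by numUnaccessed σ
decreasing_by
  all_goals exact numUnaccessed_update_lt (nextVar_unaccessed _h) (by simp)

/-- The marginal sampler: sample from `τ`, and call the overflow procedure on a star. -/
def marginSample (Φ : KCNF k n m) (ξ s : ℝ) (σ : PAssign n) (v : Fin n) : PMF (Option Bool) :=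
  (tau Φ ξ).bind fun a =>
    match a with
    | some b => PMF.pure (some b)
    | none => marginOverflow Φ ξ s (Function.update σ v Status.star) v

/-- The for-loop of the sampler over a list of variables; `none` means halted. -/
def sampleLoop (Φ : KCNF k n m) (ξ s : ℝ) : List (Fin n) → PAssign n → PMF (Option (PAssign n))
  | [], σ => PMF.pure (some σ)
  | v :: vs, σ =>
    if v ∈ alive Φ ξ σ then
      (marginSample Φ ξ s σ v).bind fun r =>
        match r with
        | none => PMF.pure none
        | some b => sampleLoop Φ ξ s vs (Function.update σ v (Status.bit b))
    else sampleLoop Φ ξ s vs σ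

/-- Outcomes of the whole algorithm: halted by a truncation, an endless rejection loop, or a
complete assignment. -/
inductive Outcome (n : ℕ) : Type
  | halted
  | endless
  | output (x : Fin n → Bool)

/-- The law of the final rejection sampling: uniform on the solutions of `Φ^σ`; without any
solution the loop never ends. -/
def rejectionSampling (Φ : KCNF k n m) (σ : PAssign n) : PMF (Outcome n) :=
  if h : (completions Φ σ).Nonempty then
    (PMF.uniformOfFinset (completions Φ σ) h).map Outcome.output
  else PMF.pure Outcome.endless

/-- The law of the outcome of the sampling algorithm with truncation parameter `s`. -/
def solutionSampling (Φ : KCNF k n m) (ξ s : ℝ) : PMF (Outcome n) :=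
  (sampleLoop Φ ξ s (List.finRange n) fun _ => Status.unaccessed).bind fun r =>
    match r with
    | none => PMF.pure Outcome.halted
    | some σ =>
      if HasLargeComponent Φ s σ then PMF.pure Outcome.halted else rejectionSampling Φ σ

/-- The probability that a truncation happens during the algorithm. -/
def pHalt (Φ : KCNF k n m) (ξ s : ℝ) : ℝ :=
  (solutionSampling Φ ξ s Outcome.halted).toReal

/-! ### The trees and the depth -/

/-- `RecNode Φ ξ s σ d π`: the partial assignment `π` is a node of depth `d` in the recursive
cost tree rooted at `σ`. -/
inductive RecNode (Φ : KCNF k n m) (ξ s : ℝ) (σ : PAssign n) : ℕ → PAssign n → Prop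
  | root : RecNode Φ ξ s σ 0 σ
  | child (d : ℕ) (π : PAssign n) (u : Fin n) (a : Status) : RecNode Φ ξ s σ d π →
      ((Ccon Φ ξ π).card : ℝ) ≤ s → nextVar Φ ξ π = some u → a ≠ Status.unaccessed →
      RecNode Φ ξ s σ (d + 1) (Function.update π u a)

/-- The nodes of the simulation tree up to and including the recursing nodes, at which the
recursive cost trees are attached. -/
inductive SimNode (Φ : KCNF k n m) (ξ : ℝ) : PAssign n → Prop
  | root : SimNode Φ ξ fun _ => Status.unaccessed
  | child (π : PAssign n) (u : Fin n) (a : Status) : SimNode Φ ξ π →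
      (∀ v, π v ≠ Status.star) → leastVar (alive Φ ξ π) = some u → a ≠ Status.unaccessed →
      SimNode Φ ξ (Function.update π u a)

/-- The recursing nodes of the simulation tree. -/
def RecursingNode (Φ : KCNF k n m) (ξ : ℝ) (σ : PAssign n) : Prop :=
  SimNode Φ ξ σ ∧ ∃ v, σ v = Status.star

/-- The maximal depth of a recursive cost tree attached to the simulation tree (zero if there
is none; depths are bounded by `n`). -/
def recDepth (Φ : KCNF k n m) (ξ s : ℝ) : ℕ :=
  sSup {d | ∃ σ π, RecursingNode Φ ξ σ ∧ RecNode Φ ξ s σ d π}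

end RandomKSat

end

noncomputable section

namespace RandomKSat

open scoped Classical

variable {k n m : ℕ} {Φ : KCNF k n m} {ξ s : ℝ}

/-! ### The separator construction -/

/-! Write L = s/(6k⁴α). A truncation forces a large, unlikely configuration of clauses to be
present. The proof is a union bound over these configurations, carried along the run by a potential
function.

Combinatorial half. Call frozen, bad and separator clauses blocked. From the root star (in the final
phase: from a variable of a large component) a linked set S of clauses is grown through blocked
clauses and through clauses containing a star not yet covered. Each clause of the second kind is
charged to its own star, collected in U. If the growth got stuck with at most L clauses, every
clause of `Ccon` would meet `vblSet Φ S`, or the component would lie inside S. Property (9) with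
(2), respectively the size of S, then leaves at most s clauses, which contradicts the truncation. So
truncated states carry an explored S with more than L clauses (`explored_of_overflow`,
`explored_of_component`). At most one clause of S in k is a separator (`sep_fraction`), and the set
A of its frozen and bad clauses, none of them satisfied, has about k/3 accessed variables per clause
(`accessed_ge`).

Probabilistic half. The potential of a witness (A, U) gains a factor 1/δ for each starred variable
of U and almost 2 for each other accessed variable of A. It vanishes once a variable of U receives a
bit, or a variable of A outside U a bit satisfying a clause of A. It is a supermartingale when a
variable receives a bit. In the overflow procedure a star triggers both a recursive call and a
continuation, so the three outcomes have total mass up to 1 + δ. This costs a factor 1 + δ per level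
of the tree and produces the power of 1 + δ. Of the law of the returned bits only the bound (1 +
δ)/2 on the probability of each value is used. Hence any potential that is at least 1 at truncated
states bounds the halting probability by its initial value times n(1+δ)^d + 1, with d the recursion
depth (`marginOverflow_halt_le`, `sampleLoop_halt_le`).

The potential used is a weighted sum over all witnesses, and its initial value is the sum of the
weights. Each clause of A or star of U weighs at most `price`, that is 1/(k³⁰·ek²α). This beats the
number of connected sets, the number of splittings and the weightless separators
(`sum_witnesses_le`). The remaining polynomial factors fit into n¹⁰. -/

theorem card_vbl_le (Φ : KCNF k n m) (C : Fin m) : (vbl Φ C).card ≤ k :=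
  Finset.card_image_le.trans (by simp)

theorem card_vblSet_le (Φ : KCNF k n m) (S : Finset (Fin m)) :
    (vblSet Φ S).card ≤ k * S.card := by
  rw [mul_comm]
  exact Finset.card_biUnion_le_card_mul _ _ _ fun C _ => card_vbl_le Φ C

theorem vbl_subset_vblSet {S : Finset (Fin m)} {C : Fin m} (h : C ∈ S) :
    vbl Φ C ⊆ vblSet Φ S :=
  Finset.subset_biUnion_of_mem (vbl Φ) h

/-- The variables of degree at least `D`. -/
def highVars (Φ : KCNF k n m) (ξ : ℝ) : Finset (Fin n) :=
  Finset.univ.filter fun v => highDeg Φ ξ ≤ (degree Φ v : ℝ)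

/-- The state of the separator construction after `i` iterations. -/
def sepState (Φ : KCNF k n m) (ξ : ℝ) (i : ℕ) : Finset (Fin n) × Finset (Fin m) :=
  (sepStep Φ)^[i] (highVars Φ ξ, ∅)

theorem sepState_zero : sepState Φ ξ 0 = (highVars Φ ξ, ∅) := rfl

theorem sepState_succ (i : ℕ) : sepState Φ ξ (i + 1) = sepStep Φ (sepState Φ ξ i) :=
  Function.iterate_succ_apply' _ _ _

theorem Csep_eq : Csep Φ ξ = (sepState Φ ξ m).2 := rfl

theorem sepStep_cases (Φ : KCNF k n m) (p : Finset (Fin n) × Finset (Fin m)) :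
    (sepEligible Φ p = ∅ ∧ sepStep Φ p = p) ∨
      ∃ C, C ∉ p.2 ∧ 2 * eta Φ * k ≤ ((vbl Φ C ∩ p.1).card : ℝ) ∧
        sepStep Φ p = (p.1 ∪ vbl Φ C, insert C p.2) := by
  by_cases h : (sepEligible Φ p).Nonempty
  · right
    have hm := Finset.min'_mem _ h
    refine ⟨(sepEligible Φ p).min' h, ?_, ?_, by rw [sepStep, dif_pos h]⟩
    · exact (Finset.mem_filter.1 hm).2.1
    · exact (Finset.mem_filter.1 hm).2.2
  · left
    exact ⟨Finset.not_nonempty_iff_eq_empty.1 h, by rw [sepStep, dif_neg h]⟩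

theorem sepState_snd_mono (i j : ℕ) (h : i ≤ j) :
    (sepState Φ ξ i).2 ⊆ (sepState Φ ξ j).2 := by
  induction j, h using Nat.le_induction with
  | base => exact subset_rfl
  | succ j _ ih =>
    refine ih.trans ?_
    rw [sepState_succ]
    rcases sepStep_cases Φ (sepState Φ ξ j) with ⟨_, h⟩ | ⟨C, _, _, h⟩
    · rw [h]
    · rw [h]; exact Finset.subset_insert _ _

theorem sepState_vbl_subset (i : ℕ) : vblSet Φ (sepState Φ ξ i).2 ⊆ (sepState Φ ξ i).1 := by
  induction i with
  | zero => simp [sepState_zero, vblSet]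
  | succ i ih =>
    rw [sepState_succ]
    rcases sepStep_cases Φ (sepState Φ ξ i) with ⟨_, h⟩ | ⟨C, _, _, h⟩
    · rwa [h]
    · rw [h]
      simp only [vblSet, Finset.biUnion_insert] at ih ⊢
      exact Finset.union_subset Finset.subset_union_right (ih.trans Finset.subset_union_left)

/-- A state with nothing eligible is a fixed point, and every other iteration adds a new clause.
After `m` iterations either alternative leaves no eligible clause. -/
theorem sepState_card (i : ℕ) :
    sepEligible Φ (sepState Φ ξ i) = ∅ ∨ i ≤ (sepState Φ ξ i).2.card := by
  induction i with
  | zero => right; simp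
  | succ i ih =>
    rw [sepState_succ]
    rcases sepStep_cases Φ (sepState Φ ξ i) with ⟨h0, h⟩ | ⟨C, hC, hC', h⟩
    · left; rwa [h]
    · right
      rcases ih with ih | ih
      · have : C ∈ sepEligible Φ (sepState Φ ξ i) := by
          simp only [sepEligible, Finset.mem_filter, Finset.mem_univ, true_and]
          exact ⟨hC, hC'⟩
        simp [ih] at this
      · rw [h, Finset.card_insert_of_notMem hC]; omega

theorem card_inter_Vsep_lt {C : Fin m} (hC : C ∉ Csep Φ ξ) :
    ((vbl Φ C ∩ Vsep Φ ξ).card : ℝ) < 2 * eta Φ * k := by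
  by_contra! hcon
  have hmem : C ∈ sepEligible Φ (sepState Φ ξ m) := by
    simp only [sepEligible, Finset.mem_filter, Finset.mem_univ, true_and]
    exact ⟨hC, hcon⟩
  rcases sepState_card (Φ := Φ) (ξ := ξ) m with h | h
  · simp [h] at hmem
  · have : (sepState Φ ξ m).2 = Finset.univ := by
      rw [← Finset.card_eq_iff_eq_univ]
      exact le_antisymm (Finset.card_le_univ _) (by simpa using h)
    exact hC (by rw [Csep_eq, this]; exact Finset.mem_univ _)

/-- Growth of the variables covered by the construction inside a closed set of separators. -/
theorem sepState_card_inter_le {Y : Finset (Fin m)} {Z : Finset (Fin n)} (i : ℕ)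
    (hout : ∀ C ∈ (sepState Φ ξ i).2, C ∉ Y → Disjoint (vbl Φ C) Z) :
    (((sepState Φ ξ i).1 ∩ Z).card : ℝ) ≤
      (highVars Φ ξ ∩ Z).card + (k - 2 * eta Φ * k) * ((sepState Φ ξ i).2 ∩ Y).card := by
  induction i with
  | zero => simp [sepState_zero]
  | succ i ih =>
    have ih' := ih fun C hC => hout C (sepState_snd_mono i (i + 1) (Nat.le_succ i) hC)
    rw [sepState_succ] at hout ⊢
    rcases sepStep_cases Φ (sepState Φ ξ i) with ⟨_, h⟩ | ⟨C, hC, hC2, h⟩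
    · rwa [h]
    · rw [h] at hout ⊢
      simp only [Finset.mem_insert, forall_eq_or_imp] at hout
      -- An eligible clause already has 2ηk variables in the current set, so it brings at most k −
      -- 2ηk new ones. A clause outside `Y` is disjoint from `Z` and brings none there.
      by_cases hY : C ∈ Y
      · have h1 : insert C (sepState Φ ξ i).2 ∩ Y = insert C ((sepState Φ ξ i).2 ∩ Y) :=
          Finset.insert_inter_of_mem hY
        have h2 : C ∉ (sepState Φ ξ i).2 ∩ Y := fun h => hC (Finset.mem_inter.1 h).1
        have h3 : ((sepState Φ ξ i).1 ∪ vbl Φ C) ∩ Z ⊆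
            ((sepState Φ ξ i).1 ∩ Z) ∪ (vbl Φ C \ (sepState Φ ξ i).1) := by
          intro v hv
          simp only [Finset.mem_inter, Finset.mem_union, Finset.mem_sdiff] at hv ⊢
          tauto
        have h4 := (Finset.card_le_card h3).trans (Finset.card_union_le _ _)
        have h5 := Finset.card_sdiff_add_card_inter (vbl Φ C) (sepState Φ ξ i).1
        have h6 := card_vbl_le Φ C
        dsimp only
        rw [h1, Finset.card_insert_of_notMem h2]
        have h4' : ((((sepState Φ ξ i).1 ∪ vbl Φ C) ∩ Z).card : ℝ) ≤
            ((sepState Φ ξ i).1 ∩ Z).card + (vbl Φ C \ (sepState Φ ξ i).1).card := by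
          exact_mod_cast h4
        have h5' : ((vbl Φ C \ (sepState Φ ξ i).1).card : ℝ) +
            (vbl Φ C ∩ (sepState Φ ξ i).1).card = (vbl Φ C).card := by exact_mod_cast h5
        have h6' : ((vbl Φ C).card : ℝ) ≤ k := by exact_mod_cast h6
        push_cast
        linarith
      · have h1 : insert C (sepState Φ ξ i).2 ∩ Y = (sepState Φ ξ i).2 ∩ Y :=
          Finset.insert_inter_of_notMem hY
        have h3 : ((sepState Φ ξ i).1 ∪ vbl Φ C) ∩ Z = (sepState Φ ξ i).1 ∩ Z := by
          rw [Finset.union_inter_distrib_right,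
            Finset.disjoint_iff_inter_eq_empty.1 (hout.1 hY), Finset.union_empty]
        dsimp only
        rw [h1, h3]
        exact ih'

/-- A set of separator clauses that is closed under intersection covers few variables besides
those of high degree. -/
theorem card_vblSet_le_of_closed {X : Finset (Fin m)} (hX : X ⊆ Csep Φ ξ)
    (hcl : ∀ C ∈ X, ∀ C' ∈ Csep Φ ξ, (vbl Φ C ∩ vbl Φ C').Nonempty → C' ∈ X) :
    ((vblSet Φ X).card : ℝ) ≤
      (highVars Φ ξ ∩ vblSet Φ X).card + (k - 2 * eta Φ * k) * X.card := by
  -- By closure of `X`, a separator outside `X` shares no variable with `vblSet Φ X`, so the growth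
  -- inside this set is due to `X` alone.
  have h := sepState_card_inter_le (Φ := Φ) (ξ := ξ) (Y := X) (Z := vblSet Φ X) m (fun C hC hCX => by
      rw [Finset.disjoint_left]
      intro v hv hvX
      obtain ⟨C', hC', hv'⟩ := Finset.mem_biUnion.1 hvX
      exact hCX (hcl C' hC' C hC ⟨v, Finset.mem_inter.2 ⟨hv', hv⟩⟩))
  have h1 : (sepState Φ ξ m).1 ∩ vblSet Φ X = vblSet Φ X :=
    Finset.inter_eq_right.2 ((Finset.biUnion_subset_biUnion_of_subset_left _ hX).trans
      (sepState_vbl_subset m))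
  have h2 : (sepState Φ ξ m).2 ∩ X = X := Finset.inter_eq_right.2 hX
  rwa [h1, h2] at h

/-- If small sets of clauses cover many variables, there are few separator clauses. -/
theorem card_sepState_le (heta : 0 ≤ eta Φ) (hd : DistinctVarsProp Φ)
    {N : ℝ} (hN : ((highVars Φ ξ).card : ℝ) ≤ N) (hk : 1 ≤ eta Φ * k)
    (hN' : N + 1 ≤ n / (2 : ℝ) ^ (2 * (k : ℝ) / Real.logb 2 k)) (i : ℕ) :
    ((sepState Φ ξ i).2.card : ℝ) ≤ N := by
  have hbound : ∀ i, ((sepState Φ ξ i).1.card : ℝ) ≤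
      (highVars Φ ξ).card + (k - 2 * eta Φ * k) * (sepState Φ ξ i).2.card := fun i => by
    simpa using sepState_card_inter_le (Φ := Φ) (ξ := ξ) (Y := Finset.univ)
      (Z := Finset.univ) i (by simp)
  have hN0 : 0 ≤ N := (Nat.cast_nonneg _).trans hN
  induction i with
  | zero => simpa [sepState_zero] using hN0
  | succ i ih =>
    -- The induction hypothesis gives at most N before the step, hence at most N + 1 after it. This
    -- crude bound already allows the covering property to be applied.
    have hle : ((sepState Φ ξ (i + 1)).2.card : ℝ) ≤ N + 1 := by
      rw [sepState_succ]
      rcases sepStep_cases Φ (sepState Φ ξ i) with ⟨_, h⟩ | ⟨C, hC, hC2, h⟩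
      · rw [h]; linarith
      · rw [h, Finset.card_insert_of_notMem hC]; push_cast; linarith
    rcases Nat.eq_zero_or_pos (sepState Φ ξ (i + 1)).2.card with h0 | h0
    · rw [h0]; simpa using hN0
    · have h1 := hd _ h0 (hle.trans hN')
      have h2 : ((vblSet Φ (sepState Φ ξ (i + 1)).2).card : ℝ) ≤ (sepState Φ ξ (i + 1)).1.card := by
        exact_mod_cast Finset.card_le_card (sepState_vbl_subset (i + 1))
      have h3 := hbound (i + 1)
      set q : ℝ := ((sepState Φ ξ (i + 1)).2.card : ℝ) with hq
      have hq0 : 0 ≤ q := Nat.cast_nonneg _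
      -- The covering lower bound exceeds the term (k − 2ηk)q of the upper bound by at least ηkq ≥
      -- q. So q is at most the number of high-degree variables.
      have h4 : (k : ℝ) * q / (1 + eta Φ) - (k - 2 * eta Φ * k) * q =
          eta Φ * k * q + eta Φ ^ 2 * k * q / (1 + eta Φ) := by
        field_simp
        ring
      have h5 : 1 * q ≤ eta Φ * k * q := by gcongr
      have h6 : 0 ≤ eta Φ ^ 2 * k * q / (1 + eta Φ) := by positivity
      linarith

/-! ### Connectivity -/

/-- A set of vertices without a proper nonempty part closed under adjacency induces a connected
subgraph. -/
theorem induce_connected_of_closed {V : Type*} (G : SimpleGraph V) (S : Set V)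
    (hne : S.Nonempty)
    (h : ∀ T ⊆ S, T.Nonempty → (∀ a ∈ T, ∀ b ∈ S, G.Adj a b → b ∈ T) → S ⊆ T) :
    (G.induce S).Connected := by
  obtain ⟨a, ha⟩ := hne
  rw [SimpleGraph.connected_iff_exists_forall_reachable]
  refine ⟨⟨a, ha⟩, ?_⟩
  rintro ⟨b, hb⟩
  have := h {x | ∃ hx : x ∈ S, (G.induce S).Reachable ⟨a, ha⟩ ⟨x, hx⟩}
    (fun x hx => hx.1) ⟨a, ha, SimpleGraph.Reachable.refl _⟩ (by
      rintro x ⟨hx, hr⟩ y hy hxy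
      refine ⟨hy, hr.trans (SimpleGraph.Adj.reachable ?_)⟩
      simpa using hxy)
  exact (this hb).2

/-- Two clauses share a variable. -/
def Touch (Φ : KCNF k n m) (C C' : Fin m) : Prop := (vbl Φ C ∩ vbl Φ C').Nonempty

theorem Touch.symm {C C' : Fin m} (h : Touch Φ C C') : Touch Φ C' C := by
  unfold Touch at *; rwa [Finset.inter_comm]

theorem touch_of_mem {C C' : Fin m} {v : Fin n} (h : v ∈ vbl Φ C) (h' : v ∈ vbl Φ C') :
    Touch Φ C C' :=
  ⟨v, Finset.mem_inter.2 ⟨h, h'⟩⟩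

/-- A set of clauses without a proper nonempty part closed under intersection. -/
def Linked (Φ : KCNF k n m) (S : Finset (Fin m)) : Prop :=
  ∀ T ⊆ S, T.Nonempty → (∀ C ∈ T, ∀ C' ∈ S, Touch Φ C C' → C' ∈ T) → S ⊆ T

theorem linked_empty : Linked Φ ∅ := fun _ _ _ _ => Finset.empty_subset _

/-- The hypothesis on `C` is vacuous when `S` is empty, so the same statement also starts an
exploration with a single clause. -/
theorem Linked.insert {S : Finset (Fin m)} (hS : Linked Φ S) {C : Fin m}
    (hC : ∀ C' ∈ S, ∃ C' ∈ S, Touch Φ C' C) : Linked Φ (insert C S) := by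
  intro T hT hne hcl
  rcases S.eq_empty_or_nonempty with rfl | ⟨C₀, hC₀⟩
  · obtain ⟨a, ha⟩ := hne
    have := hT ha
    simp only [insert_empty_eq, Finset.mem_singleton] at this
    subst this
    simpa using ha
  obtain ⟨C₁, hC₁, ht⟩ := hC C₀ hC₀
  have hTS : (T ∩ S).Nonempty := by
    obtain ⟨a, ha⟩ := hne
    rcases Finset.mem_insert.1 (hT ha) with rfl | h
    · exact ⟨C₁, Finset.mem_inter.2
        ⟨hcl _ ha _ (Finset.mem_insert_of_mem hC₁) ht.symm, hC₁⟩⟩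
    · exact ⟨a, Finset.mem_inter.2 ⟨ha, h⟩⟩
  have hsub : S ⊆ T ∩ S := hS _ Finset.inter_subset_right hTS fun a ha b hb hab =>
    Finset.mem_inter.2
      ⟨hcl a (Finset.mem_inter.1 ha).1 b (Finset.mem_insert_of_mem hb) hab, hb⟩
  refine Finset.insert_subset ?_ (hsub.trans Finset.inter_subset_left)
  exact hcl _ (Finset.mem_inter.1 (hsub hC₁)).1 _ (Finset.mem_insert_self _ _) ht

theorem Linked.union_of_touch {S : Finset (Fin m)} (hS : Linked Φ S) {C : Fin m} (hC : C ∈ S)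
    (T : Finset (Fin m)) (hT : ∀ C' ∈ T, Touch Φ C C') : Linked Φ (T ∪ S) := by
  induction T using Finset.induction_on with
  | empty => simpa using hS
  | insert a T _ ih =>
    rw [Finset.insert_union]
    exact (ih fun C' h => hT C' (Finset.mem_insert_of_mem h)).insert fun _ _ =>
      ⟨C, Finset.mem_union_right _ hC, hT a (Finset.mem_insert_self _ _)⟩

theorem Linked.connected {S : Finset (Fin m)} (hS : Linked Φ S) (hne : S.Nonempty) :
    ((clauseGraph Φ).induce (S : Set (Fin m))).Connected := by
  refine induce_connected_of_closed _ _ (by simpa using hne) fun T hT hTne hcl => ?_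
  have hfin : T = ((S.filter (· ∈ T) : Finset (Fin m)) : Set (Fin m)) := by
    ext x
    simp only [Finset.coe_filter, Set.mem_ofPred_eq]
    exact ⟨fun h => ⟨hT h, h⟩, fun h => h.2⟩
  have := hS (S.filter (· ∈ T)) (Finset.filter_subset _ _)
    (by rw [← Finset.coe_nonempty, ← hfin]; exact hTne) (by
      intro C hC C' hC' ht
      rw [Finset.mem_filter] at hC ⊢
      refine ⟨hC', ?_⟩
      by_cases hCC : C = C'
      · exact hCC ▸ hC.2
      · refine hcl C hC.2 C' hC' ?_
        rw [clauseGraph, SimpleGraph.fromRel_adj]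
        exact ⟨hCC, Or.inl ht⟩)
  intro x hx
  exact (Finset.mem_filter.1 (this hx)).2

/-- A part of the variables closed under adjacency contains all variables of a clause or none. The
clauses meeting it therefore form a part of `S` closed under touching. -/
theorem Linked.variables_connected {S : Finset (Fin m)} (hS : Linked Φ S)
    (hne : (vblSet Φ S).Nonempty) :
    ((variableGraph Φ).induce (vblSet Φ S : Set (Fin n))).Connected := by
  refine induce_connected_of_closed _ _ (by simpa using hne) fun T hT hTne hcl => ?_
  have hclause : ∀ C ∈ S, ∀ v ∈ vbl Φ C, v ∈ T → ∀ w ∈ vbl Φ C, w ∈ T := by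
    intro C hC v hv hvT w hw
    by_cases hvw : v = w
    · exact hvw ▸ hvT
    · refine hcl v hvT w (vbl_subset_vblSet hC hw) ?_
      rw [variableGraph, SimpleGraph.fromRel_adj]
      exact ⟨hvw, Or.inl ⟨C, hv, hw⟩⟩
  have := hS (S.filter fun C => ∃ v ∈ vbl Φ C, v ∈ T) (Finset.filter_subset _ _)
    (by
      obtain ⟨v, hv⟩ := hTne
      obtain ⟨C, hC, hvC⟩ := Finset.mem_biUnion.1 (hT hv)
      exact ⟨C, Finset.mem_filter.2 ⟨hC, v, hvC, hv⟩⟩)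
    (by
      intro C hC C' hC' ⟨w, hw⟩
      rw [Finset.mem_inter] at hw
      rw [Finset.mem_filter] at hC ⊢
      obtain ⟨hCS, v, hv, hvT⟩ := hC
      exact ⟨hC', w, hw.2, hclause C hCS v hv hvT w hw.1⟩)
  intro w hw
  obtain ⟨C, hC, hwC⟩ := Finset.mem_biUnion.1 hw
  obtain ⟨hCS, v, hv, hvT⟩ := Finset.mem_filter.1 (this hC)
  exact hclause C hCS v hv hvT w hwC

/-! ### Monotonicity of the frozen and the bad clauses -/

theorem mem_unassigned {σ : PAssign n} {v : Fin n} :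
    v ∈ unassigned σ ↔ σ v = Status.star ∨ σ v = Status.unaccessed := by
  simp [unassigned]

theorem mem_frozen {σ : PAssign n} {C : Fin m} :
    C ∈ frozen Φ ξ σ ↔ ¬ SatBy Φ σ C ∧ C ∉ Csep Φ ξ ∧
      (((vbl Φ C ∩ unassigned σ) \ Vsep Φ ξ).card : ℝ) < 1 + (2 / 3 - 2 * eta Φ) * k := by
  simp [frozen]

theorem mem_bad {σ : PAssign n} {C : Fin m} :
    C ∈ bad Φ ξ σ ↔ ¬ SatBy Φ σ C ∧ C ∉ frozen Φ ξ σ ∪ Csep Φ ξ ∧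
      ∀ v ∈ vbl Φ C \ Vsep Φ ξ, σ v = Status.unaccessed → ∃ C' ∈ frozen Φ ξ σ, v ∈ vbl Φ C' := by
  simp only [bad, Finset.mem_filter, Finset.mem_univ, true_and]

theorem mem_alive {σ : PAssign n} {v : Fin n} :
    v ∈ alive Φ ξ σ ↔ σ v = Status.unaccessed ∧ v ∉ Vsep Φ ξ ∧
      ∀ C, C ∉ Csep Φ ξ → SatBy Φ σ C ∨ (2 / 3 - 2 * eta Φ) * k ≤
        (((vbl Φ C ∩ unassigned σ) \ (Vsep Φ ξ ∪ {v})).card : ℝ) := by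
  simp only [alive, Finset.mem_filter, Finset.mem_univ, true_and]

/-- The clauses that are frozen, bad, or separators. -/
def blocked (Φ : KCNF k n m) (ξ : ℝ) (σ : PAssign n) : Finset (Fin m) :=
  frozen Φ ξ σ ∪ bad Φ ξ σ ∪ Csep Φ ξ

theorem sdiff_union_singleton_eq_erase (A V : Finset (Fin n)) (v : Fin n) :
    A \ (V ∪ {v}) = (A \ V).erase v := by
  ext x
  simp only [Finset.mem_sdiff, Finset.mem_union, Finset.mem_singleton, Finset.mem_erase]
  tauto

/-- The threshold for frozen is one more than that for alive because aliveness does not count the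
variable itself. Removing `u` from a frozen clause would bring the count below the alive threshold.
-/
theorem not_mem_vbl_of_frozen {σ : PAssign n} {u : Fin n} (hu : u ∈ alive Φ ξ σ) {C : Fin m}
    (hC : C ∈ frozen Φ ξ σ) : u ∉ vbl Φ C := by
  intro huC
  rw [mem_alive] at hu
  obtain ⟨hsat, hsep, hlt⟩ := mem_frozen.1 hC
  rcases hu.2.2 C hsep with h | h
  · exact hsat h
  · have hmem : u ∈ (vbl Φ C ∩ unassigned σ) \ Vsep Φ ξ := by
      simp only [Finset.mem_sdiff, Finset.mem_inter, mem_unassigned]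
      exact ⟨⟨huC, Or.inr hu.1⟩, hu.2.1⟩
    have hcard := Finset.card_erase_add_one hmem
    rw [sdiff_union_singleton_eq_erase] at h
    have : ((((vbl Φ C ∩ unassigned σ) \ Vsep Φ ξ).erase u).card : ℝ) + 1 =
      ((vbl Φ C ∩ unassigned σ) \ Vsep Φ ξ).card := by exact_mod_cast hcard
    linarith

theorem not_mem_vbl_of_bad {σ : PAssign n} {u : Fin n} (hu : u ∈ alive Φ ξ σ) {C : Fin m}
    (hC : C ∈ bad Φ ξ σ) : u ∉ vbl Φ C := by
  intro huC
  have hu' := mem_alive.1 hu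
  obtain ⟨C', hC', huC'⟩ := (mem_bad.1 hC).2.2 u (Finset.mem_sdiff.2 ⟨huC, hu'.2.1⟩) hu'.1
  exact not_mem_vbl_of_frozen hu hC' huC'

theorem satBy_congr {σ π : PAssign n} {C : Fin m} (h : ∀ v ∈ vbl Φ C, σ v = π v) :
    SatBy Φ σ C ↔ SatBy Φ π C := by
  unfold SatBy
  refine exists_congr fun j => ?_
  rw [h _ (Finset.mem_image_of_mem _ (Finset.mem_univ j))]

theorem vbl_inter_unassigned_congr {σ π : PAssign n} {C : Fin m}
    (h : ∀ v ∈ vbl Φ C, σ v = π v) : vbl Φ C ∩ unassigned σ = vbl Φ C ∩ unassigned π := by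
  ext v
  simp only [Finset.mem_inter, mem_unassigned]
  exact and_congr_right fun hv => by rw [h v hv]

theorem frozen_congr {σ π : PAssign n} {C : Fin m} (h : ∀ v ∈ vbl Φ C, σ v = π v) :
    C ∈ frozen Φ ξ σ ↔ C ∈ frozen Φ ξ π := by
  rw [mem_frozen, mem_frozen, satBy_congr h, vbl_inter_unassigned_congr h]

theorem update_eq_of_not_mem {σ : PAssign n} {u : Fin n} {C : Fin m} (h : u ∉ vbl Φ C)
    (a : Status) : ∀ v ∈ vbl Φ C, σ v = Function.update σ u a v := by
  intro v hv
  rw [Function.update_of_ne]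
  rintro rfl
  exact h hv

theorem frozen_mono {σ : PAssign n} {u : Fin n} (hu : u ∈ alive Φ ξ σ) (a : Status) :
    frozen Φ ξ σ ⊆ frozen Φ ξ (Function.update σ u a) := fun _ hC =>
  (frozen_congr (update_eq_of_not_mem (not_mem_vbl_of_frozen hu hC) a)).1 hC

theorem bad_mono {σ : PAssign n} {u : Fin n} (hu : u ∈ alive Φ ξ σ) (a : Status) :
    bad Φ ξ σ ⊆ bad Φ ξ (Function.update σ u a) := by
  intro C hC
  have heq := update_eq_of_not_mem (σ := σ) (not_mem_vbl_of_bad hu hC) a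
  obtain ⟨hsat, hfr, hv⟩ := mem_bad.1 hC
  refine mem_bad.2 ⟨fun h => hsat ((satBy_congr heq).2 h), ?_, ?_⟩
  · simp only [Finset.mem_union, not_or] at hfr ⊢
    exact ⟨fun h => hfr.1 ((frozen_congr heq).2 h), hfr.2⟩
  · intro v hvC hvu
    rw [← heq v (Finset.mem_sdiff.1 hvC).1] at hvu
    obtain ⟨C', hC', hv'⟩ := hv v hvC hvu
    exact ⟨C', frozen_mono hu a hC', hv'⟩

/-- An alive variable lies in no frozen and no bad clause, so changing it leaves those clauses
untouched. Blocked clauses thus persist towards the leaves of the trees. -/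
theorem blocked_mono {σ : PAssign n} {u : Fin n} (hu : u ∈ alive Φ ξ σ) (a : Status) :
    blocked Φ ξ σ ⊆ blocked Φ ξ (Function.update σ u a) :=
  Finset.union_subset_union (Finset.union_subset_union (frozen_mono hu a) (bad_mono hu a))
    subset_rfl

/-! ### Sets of variables absorbing the explored region -/

/-- Every blocked clause and every starred variable next to `R` is absorbed by `R`. -/
structure Absorbing (Φ : KCNF k n m) (ξ : ℝ) (σ : PAssign n) (R : Finset (Fin n)) : Prop where
  clauses : ∀ C ∈ blocked Φ ξ σ, (vbl Φ C ∩ R).Nonempty → vbl Φ C ⊆ R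
  stars : ∀ C, (vbl Φ C ∩ R).Nonempty → ∀ u ∈ vbl Φ C, σ u = Status.star → u ∈ R

theorem leastVar_mem {S : Finset (Fin n)} {u : Fin n} (h : leastVar S = some u) : u ∈ S := by
  unfold leastVar at h
  split at h
  · rw [← Option.some.inj h]; exact Finset.min'_mem _ _
  · cases h

theorem nextVar_spec {σ : PAssign n} {u : Fin n} (h : nextVar Φ ξ σ = some u) :
    u ∈ alive Φ ξ σ ∧ ∃ C ∈ Ccon Φ ξ σ, u ∈ vbl Φ C := by
  have := Finset.mem_inter.1 (leastVar_mem h)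
  exact ⟨this.1, Finset.mem_biUnion.1 this.2⟩

theorem Absorbing.int_subset {σ : PAssign n} {R : Finset (Fin n)} (hR : Absorbing Φ ξ σ R)
    {v : Fin n} (hv : v ∈ R) {C : Fin m} (hC : InInt Φ ξ σ v C) : vbl Φ C ⊆ R := by
  induction hC with
  | base C hG hvC => exact hR.clauses C hG ⟨v, Finset.mem_inter.2 ⟨hvC, hv⟩⟩
  | step C' C _ hG hne ih =>
    obtain ⟨w, hw⟩ := hne
    simp only [Finset.mem_inter] at hw
    exact hR.clauses C hG ⟨w, Finset.mem_inter.2 ⟨hw.1.2, ih hw.1.1⟩⟩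

theorem Absorbing.con_inter {σ : PAssign n} {R : Finset (Fin n)} (hR : Absorbing Φ ξ σ R)
    (hk : 0 < k) (hst : ∀ v, σ v = Status.star → v ∈ R) {C : Fin m} (hC : C ∈ Ccon Φ ξ σ) :
    (vbl Φ C ∩ R).Nonempty := by
  obtain ⟨v, hv, h⟩ := (Finset.mem_filter.1 hC).2
  rcases h with h | h | ⟨C', hC', w, hw⟩
  · have hs := hR.int_subset (hst v hv) h
    rw [Finset.inter_eq_left.2 hs]
    exact ⟨_, Finset.mem_image_of_mem _ (Finset.mem_univ ⟨0, hk⟩)⟩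
  · exact ⟨v, Finset.mem_inter.2 ⟨h, hst v hv⟩⟩
  · simp only [Finset.mem_inter] at hw
    exact ⟨w, Finset.mem_inter.2 ⟨hw.1.2, hR.int_subset (hst v hv) hC' hw.1.1⟩⟩

/-- An absorbing set around the root star contains all stars of a node of the recursive cost
tree. -/
theorem RecNode.stars_subset {σ₀ π : PAssign n} {d : ℕ} {v₀ : Fin n} (hk : 0 < k)
    (hσ₀ : ∀ v, σ₀ v = Status.star → v = v₀) (h : RecNode Φ ξ s σ₀ d π)
    {R : Finset (Fin n)} (hv₀ : v₀ ∈ R) (hR : Absorbing Φ ξ π R) :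
    ∀ v, π v = Status.star → v ∈ R := by
  induction h with
  | root => intro v hv; rwa [hσ₀ v hv]
  | child d π u a _ _ hnext ha ih =>
    obtain ⟨hu, C, hC, huC⟩ := nextVar_spec hnext
    have hmono : ∀ v, π v = Status.star → Function.update π u a v = Status.star := by
      intro v hv
      rw [Function.update_of_ne, hv]
      rintro rfl
      rw [(mem_alive.1 hu).1] at hv
      cases hv
    -- Absorption passes from child to parent, since blocked clauses and stars of the parent
    -- persist. A star created at `u` lies in a clause of the parent's `Ccon`, which meets `R`, so
    -- the absorption of stars at the child catches it.
    have hR' : Absorbing Φ ξ π R :=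
      ⟨fun C hC => hR.clauses C (blocked_mono hu a hC),
        fun C hC w hw hws => hR.stars C hC w hw (hmono w hws)⟩
    have hst := ih hR'
    intro v hv
    by_cases hvu : v = u
    · subst hvu
      exact hR.stars C (hR'.con_inter hk hst hC) v huC hv
    · rw [Function.update_of_ne hvu] at hv
      exact hst v hv

/-! ### Exploration of a connected set of blocked and starred clauses -/

/-- A connected set of clauses that is closed under the frozen neighbours of its bad clauses and
under intersecting separators, every other clause of which is paid for by a star of `U`. -/
structure Explored (Φ : KCNF k n m) (ξ : ℝ) (σ : PAssign n) (S : Finset (Fin m))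
    (U : Finset (Fin n)) : Prop where
  linked : Linked Φ S
  bad_closed : ∀ C ∈ S, C ∈ bad Φ ξ σ → ∀ w ∈ vbl Φ C \ Vsep Φ ξ, σ w = Status.unaccessed →
    ∃ C' ∈ S, C' ∈ frozen Φ ξ σ ∧ w ∈ vbl Φ C'
  sep_closed : ∀ C ∈ S, C ∈ Csep Φ ξ → ∀ C' ∈ Csep Φ ξ, Touch Φ C C' → C' ∈ S
  stars_subset : U ⊆ vblSet Φ S
  stars : ∀ u ∈ U, σ u = Status.star
  card_stars : U.card = (S \ blocked Φ ξ σ).card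

theorem explored_empty (σ : PAssign n) : Explored Φ ξ σ ∅ ∅ :=
  ⟨linked_empty, by simp, by simp, by simp, by simp, by simp⟩

theorem vblSet_mono {S T : Finset (Fin m)} (h : S ⊆ T) : vblSet Φ S ⊆ vblSet Φ T :=
  Finset.biUnion_subset_biUnion_of_subset_left _ h

theorem frozen_subset_blocked {σ : PAssign n} : frozen Φ ξ σ ⊆ blocked Φ ξ σ :=
  Finset.subset_union_left.trans Finset.subset_union_left

theorem frozen_not_sep {σ : PAssign n} {C : Fin m} (h : C ∈ frozen Φ ξ σ) : C ∉ Csep Φ ξ :=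
  (mem_frozen.1 h).2.1

theorem bad_not_sep {σ : PAssign n} {C : Fin m} (h : C ∈ bad Φ ξ σ) : C ∉ Csep Φ ξ := fun h' =>
  (mem_bad.1 h).2.1 (Finset.mem_union_right _ h')

theorem bad_not_frozen {σ : PAssign n} {C : Fin m} (h : C ∈ bad Φ ξ σ) :
    C ∉ frozen Φ ξ σ := fun h' =>
  (mem_bad.1 h).2.1 (Finset.mem_union_left _ h')

theorem Explored.enlarge {σ : PAssign n} {S S' : Finset (Fin m)} {U : Finset (Fin n)}
    (h : Explored Φ ξ σ S U) (hSS' : S ⊆ S') (hnew : S' \ S ⊆ blocked Φ ξ σ)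
    (hlinked : Linked Φ S')
    (hbad : ∀ C ∈ S', C ∉ S → C ∈ bad Φ ξ σ → ∀ w ∈ vbl Φ C \ Vsep Φ ξ,
      σ w = Status.unaccessed → ∃ C' ∈ S', C' ∈ frozen Φ ξ σ ∧ w ∈ vbl Φ C')
    (hsep : ∀ C ∈ S', C ∉ S → C ∈ Csep Φ ξ → ∀ C' ∈ Csep Φ ξ, Touch Φ C C' → C' ∈ S') :
    Explored Φ ξ σ S' U where
  linked := hlinked
  bad_closed C hC hCb w hw hwu := by
    by_cases hCS : C ∈ S
    · obtain ⟨C', hC', h'⟩ := h.bad_closed C hCS hCb w hw hwu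
      exact ⟨C', hSS' hC', h'⟩
    · exact hbad C hC hCS hCb w hw hwu
  sep_closed C hC hCs C' hC' ht := by
    by_cases hCS : C ∈ S
    · exact hSS' (h.sep_closed C hCS hCs C' hC' ht)
    · exact hsep C hC hCS hCs C' hC' ht
  stars_subset := h.stars_subset.trans (vblSet_mono hSS')
  stars := h.stars
  card_stars := by
    rw [h.card_stars]
    congr 1
    ext C
    simp only [Finset.mem_sdiff]
    refine ⟨fun hC => ⟨hSS' hC.1, hC.2⟩, fun hC => ⟨?_, hC.2⟩⟩
    by_contra hCS
    exact hC.2 (hnew (Finset.mem_sdiff.2 ⟨hC.1, hCS⟩))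

theorem Explored.extend_frozen {σ : PAssign n} {S : Finset (Fin m)} {U : Finset (Fin n)}
    (h : Explored Φ ξ σ S U) {C : Fin m} (hC : C ∈ frozen Φ ξ σ)
    (ht : ∀ C' ∈ S, ∃ C' ∈ S, Touch Φ C' C) : Explored Φ ξ σ (insert C S) U := by
  have hnew : ∀ C' ∈ insert C S, C' ∉ S → C' = C := fun C' h1 h2 =>
    (Finset.mem_insert.1 h1).resolve_right h2
  refine h.enlarge (Finset.subset_insert _ _) ?_ (h.linked.insert ht) ?_ ?_
  · intro C' hC'
    rw [Finset.mem_sdiff] at hC'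
    exact hnew C' hC'.1 hC'.2 ▸ frozen_subset_blocked hC
  · intro C' h1 h2 h3
    exact absurd hC (hnew C' h1 h2 ▸ bad_not_frozen h3)
  · intro C' h1 h2 h3
    exact absurd h3 (hnew C' h1 h2 ▸ frozen_not_sep hC)

/-- One frozen clause is added for each unaccessed non-separator variable of `C`, at most k in all.
Frozen clauses require no further closure, so the process stops there. -/
theorem Explored.extend_bad {σ : PAssign n} {S : Finset (Fin m)} {U : Finset (Fin n)}
    (h : Explored Φ ξ σ S U) {C : Fin m} (hC : C ∈ bad Φ ξ σ)
    (ht : ∀ C' ∈ S, ∃ C' ∈ S, Touch Φ C' C) :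
    ∃ S', insert C S ⊆ S' ∧ S'.card ≤ S.card + (k + 1) ∧ Explored Φ ξ σ S' U := by
  set Q := (vbl Φ C).filter fun w => w ∉ Vsep Φ ξ ∧ σ w = Status.unaccessed with hQ
  have hex : ∀ w, ∃ C', w ∈ Q → C' ∈ frozen Φ ξ σ ∧ w ∈ vbl Φ C' := by
    intro w
    by_cases hw : w ∈ Q
    · rw [hQ, Finset.mem_filter] at hw
      obtain ⟨C', h1, h2⟩ := (mem_bad.1 hC).2.2 w (Finset.mem_sdiff.2 ⟨hw.1, hw.2.1⟩) hw.2.2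
      exact ⟨C', fun _ => ⟨h1, h2⟩⟩
    · exact ⟨C, fun h => absurd h hw⟩
  choose f hf using hex
  have hmem : ∀ C' ∈ Q.image f ∪ insert C S, C' ∉ S → C' = C ∨ C' ∈ frozen Φ ξ σ := by
    intro C' h1 h2
    rcases Finset.mem_union.1 h1 with h1 | h1
    · obtain ⟨w, hw, rfl⟩ := Finset.mem_image.1 h1
      exact Or.inr (hf w hw).1
    · exact Or.inl ((Finset.mem_insert.1 h1).resolve_right h2)
  refine ⟨Q.image f ∪ insert C S, Finset.subset_union_right, ?_, h.enlarge
    ((Finset.subset_insert _ _).trans Finset.subset_union_right) ?_ ?_ ?_ ?_⟩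
  · have h1 : (Q.image f).card ≤ k :=
      Finset.card_image_le.trans ((Finset.card_filter_le _ _).trans (card_vbl_le Φ C))
    have h2 := Finset.card_insert_le C S
    have h3 := Finset.card_union_le (Q.image f) (insert C S)
    omega
  · intro C' hC'
    rw [Finset.mem_sdiff] at hC'
    rcases hmem C' hC'.1 hC'.2 with rfl | h'
    · exact Finset.mem_union_left _ (Finset.mem_union_right _ hC)
    · exact frozen_subset_blocked h'
  · refine (h.linked.insert ht).union_of_touch (Finset.mem_insert_self _ _) _ ?_
    intro C' hC'
    obtain ⟨w, hw, rfl⟩ := Finset.mem_image.1 hC'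
    exact touch_of_mem (Finset.mem_filter.1 hw).1 (hf w hw).2
  · intro C' h1 h2 h3 w hw hwu
    rcases hmem C' h1 h2 with rfl | h'
    · have hwQ : w ∈ Q := by
        rw [Finset.mem_sdiff] at hw
        exact Finset.mem_filter.2 ⟨hw.1, hw.2, hwu⟩
      exact ⟨f w, Finset.mem_union_left _ (Finset.mem_image_of_mem f hwQ), hf w hwQ⟩
    · exact absurd h' (bad_not_frozen h3)
  · intro C' h1 h2 h3
    rcases hmem C' h1 h2 with rfl | h'
    · exact absurd h3 (bad_not_sep hC)
    · exact absurd h3 (frozen_not_sep h')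

/-- A largest linked set between `insert C S` and `S ∪ Csep Φ ξ` is taken. A separator touching it
could still be added, so maximality gives the closure under intersecting separators. -/
theorem Explored.extend_sep {σ : PAssign n} {S : Finset (Fin m)} {U : Finset (Fin n)}
    (h : Explored Φ ξ σ S U) {C : Fin m} (hC : C ∈ Csep Φ ξ)
    (ht : ∀ C' ∈ S, ∃ C' ∈ S, Touch Φ C' C) :
    ∃ S', insert C S ⊆ S' ∧ S'.card ≤ S.card + (Csep Φ ξ).card ∧ Explored Φ ξ σ S' U := by
  set F := Finset.univ.filter fun T : Finset (Fin m) =>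
    insert C S ⊆ T ∧ T ⊆ S ∪ Csep Φ ξ ∧ Linked Φ T with hF
  have hne : F.Nonempty := ⟨insert C S, by
    simp only [hF, Finset.mem_filter, Finset.mem_univ, true_and, subset_rfl]
    exact ⟨Finset.insert_subset (Finset.mem_union_right _ hC) Finset.subset_union_left,
      h.linked.insert ht⟩⟩
  obtain ⟨S', hS', hmax⟩ := Finset.exists_max_image F Finset.card hne
  obtain ⟨hsub, hsup, hlink⟩ := (Finset.mem_filter.1 hS').2
  have hnew : ∀ C' ∈ S', C' ∉ S → C' ∈ Csep Φ ξ := fun C' h1 h2 =>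
    (Finset.mem_union.1 (hsup h1)).resolve_left h2
  refine ⟨S', hsub, (Finset.card_le_card hsup).trans (Finset.card_union_le _ _),
    h.enlarge ((Finset.subset_insert _ _).trans hsub) ?_ hlink ?_ ?_⟩
  · intro C' hC'
    rw [Finset.mem_sdiff] at hC'
    exact Finset.mem_union_right _ (hnew C' hC'.1 hC'.2)
  · intro C' h1 h2 h3
    exact absurd (hnew C' h1 h2) (bad_not_sep h3)
  · intro C₁ h1 _ _ C₂ hC₂ htouch
    by_contra hcon
    have hmem : insert C₂ S' ∈ F := by
      simp only [hF, Finset.mem_filter, Finset.mem_univ, true_and]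
      exact ⟨hsub.trans (Finset.subset_insert _ _),
        Finset.insert_subset (Finset.mem_union_right _ hC₂) hsup,
        hlink.insert fun _ _ => ⟨C₁, h1, htouch⟩⟩
    have := hmax _ hmem
    rw [Finset.card_insert_of_notMem hcon] at this
    omega

theorem Explored.extend_blocked {σ : PAssign n} {S : Finset (Fin m)} {U : Finset (Fin n)}
    (h : Explored Φ ξ σ S U) {C : Fin m} (hC : C ∈ blocked Φ ξ σ)
    (ht : ∀ C' ∈ S, ∃ C' ∈ S, Touch Φ C' C) :
    ∃ S', insert C S ⊆ S' ∧ S'.card ≤ S.card + (k + 1 + (Csep Φ ξ).card) ∧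
      Explored Φ ξ σ S' U := by
  simp only [blocked, Finset.mem_union] at hC
  rcases hC with (hC | hC) | hC
  · refine ⟨_, subset_rfl, ?_, h.extend_frozen hC ht⟩
    have := Finset.card_insert_le C S
    omega
  · obtain ⟨S', h1, h2, h3⟩ := h.extend_bad hC ht
    exact ⟨S', h1, by omega, h3⟩
  · obtain ⟨S', h1, h2, h3⟩ := h.extend_sep hC ht
    exact ⟨S', h1, by omega, h3⟩

/-- The star `u` is not covered by `S`, hence it is not in `U` and can pay for `C`. The equality
between charged clauses and stars survives. -/
theorem Explored.extend_star {σ : PAssign n} {S : Finset (Fin m)} {U : Finset (Fin n)}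
    (h : Explored Φ ξ σ S U) {C : Fin m} (hC : C ∉ blocked Φ ξ σ)
    (ht : ∀ C' ∈ S, ∃ C' ∈ S, Touch Φ C' C) {u : Fin n} (hu : u ∈ vbl Φ C)
    (hus : σ u = Status.star) (huS : u ∉ vblSet Φ S) :
    Explored Φ ξ σ (insert C S) (insert u U) where
  linked := h.linked.insert ht
  bad_closed C' hC' hb w hw hwu := by
    rcases Finset.mem_insert.1 hC' with rfl | hC'
    · exact absurd (Finset.mem_union_left _ (Finset.mem_union_right _ hb)) hC
    · obtain ⟨C'', h1, h2⟩ := h.bad_closed C' hC' hb w hw hwu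
      exact ⟨C'', Finset.mem_insert_of_mem h1, h2⟩
  sep_closed C' hC' hs C'' hs' ht' := by
    rcases Finset.mem_insert.1 hC' with rfl | hC'
    · exact absurd (Finset.mem_union_right _ hs) hC
    · exact Finset.mem_insert_of_mem (h.sep_closed C' hC' hs C'' hs' ht')
  stars_subset := Finset.insert_subset (vbl_subset_vblSet (Finset.mem_insert_self _ _) hu)
    (h.stars_subset.trans (vblSet_mono (Finset.subset_insert _ _)))
  stars := by
    intro w hw
    rcases Finset.mem_insert.1 hw with rfl | hw
    · exact hus
    · exact h.stars w hw
  card_stars := by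
    have h1 : u ∉ U := fun hU => huS (h.stars_subset hU)
    have h2 : C ∉ S \ blocked Φ ξ σ := fun hCS =>
      huS (vbl_subset_vblSet (Finset.mem_sdiff.1 hCS).1 hu)
    rw [Finset.insert_sdiff_of_notMem _ hC, Finset.card_insert_of_notMem h1,
      Finset.card_insert_of_notMem h2, h.card_stars]

/-- Nothing blocked or starred next to `S` and `v` is left to explore. -/
def Exhausted (Φ : KCNF k n m) (ξ : ℝ) (σ : PAssign n) (v : Fin n) (S : Finset (Fin m)) : Prop :=
  (∀ C ∈ blocked Φ ξ σ, (vbl Φ C ∩ insert v (vblSet Φ S)).Nonempty → C ∈ S) ∧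
    ∀ C, (vbl Φ C ∩ insert v (vblSet Φ S)).Nonempty → ∀ u ∈ vbl Φ C, σ u = Status.star →
      u ∈ insert v (vblSet Φ S)

theorem Exhausted.absorbing {σ : PAssign n} {v : Fin n} {S : Finset (Fin m)}
    (h : Exhausted Φ ξ σ v S) : Absorbing Φ ξ σ (insert v (vblSet Φ S)) :=
  ⟨fun C hC hne => (vbl_subset_vblSet (h.1 C hC hne)).trans (Finset.subset_insert _ _), h.2⟩

/-- One step of the exploration. -/
theorem Explored.exists_extension {σ : PAssign n} {v : Fin n} {S : Finset (Fin m)}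
    {U : Finset (Fin n)} (h : Explored Φ ξ σ S U) (hv : S.Nonempty → v ∈ vblSet Φ S)
    (hv' : σ v = Status.star ∨ ∃ C ∈ blocked Φ ξ σ, v ∈ vbl Φ C)
    (hvC : ∃ C, v ∈ vbl Φ C) (hS : S.Nonempty → ¬ Exhausted Φ ξ σ v S) :
    ∃ S' U', S.card < S'.card ∧ S'.card ≤ S.card + (k + 1 + (Csep Φ ξ).card) ∧
      v ∈ vblSet Φ S' ∧ Explored Φ ξ σ S' U' := by
  have hblocked : ∀ C ∈ blocked Φ ξ σ, (vbl Φ C ∩ insert v (vblSet Φ S)).Nonempty → C ∉ S →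
      ∃ S' U', S.card < S'.card ∧ S'.card ≤ S.card + (k + 1 + (Csep Φ ξ).card) ∧
        v ∈ vblSet Φ S' ∧ Explored Φ ξ σ S' U' := by
    intro C hC hne hCS
    have ht : ∀ C' ∈ S, ∃ C' ∈ S, Touch Φ C' C := by
      intro C₀ hC₀
      rw [Finset.insert_eq_self.2 (hv ⟨C₀, hC₀⟩)] at hne
      obtain ⟨w, hw⟩ := hne
      obtain ⟨C', hC', hw'⟩ := Finset.mem_biUnion.1 (Finset.mem_inter.1 hw).2
      exact ⟨C', hC', touch_of_mem hw' (Finset.mem_inter.1 hw).1⟩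
    obtain ⟨S', h1, h2, h3⟩ := h.extend_blocked hC ht
    refine ⟨S', U, ?_, h2, ?_, h3⟩
    · have := Finset.card_le_card h1
      rw [Finset.card_insert_of_notMem hCS] at this
      omega
    · rcases S.eq_empty_or_nonempty with rfl | hne'
      · refine vbl_subset_vblSet (h1 (Finset.mem_insert_self _ _)) ?_
        obtain ⟨w, hw⟩ := hne
        simp only [vblSet, Finset.biUnion_empty, insert_empty_eq, Finset.mem_inter,
          Finset.mem_singleton] at hw
        exact hw.2 ▸ hw.1
      · exact vblSet_mono ((Finset.subset_insert _ _).trans h1) (hv hne')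
  -- Blocked clauses are used up first. Afterwards any clause that leads to an uncovered star is not
  -- blocked, as charging it to that star requires. If `S` is still empty, `v` itself must be the
  -- star.
  by_cases hB : ∃ C ∈ blocked Φ ξ σ, (vbl Φ C ∩ insert v (vblSet Φ S)).Nonempty ∧ C ∉ S
  · obtain ⟨C, h1, h2, h3⟩ := hB
    exact hblocked C h1 h2 h3
  push Not at hB
  rcases S.eq_empty_or_nonempty with rfl | hne
  · obtain ⟨C, hC⟩ := hvC
    have hnot : ∀ C ∈ blocked Φ ξ σ, v ∉ vbl Φ C := fun C' h1 h2 => by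
      simpa using hB C' h1 ⟨v, Finset.mem_inter.2 ⟨h2, Finset.mem_insert_self _ _⟩⟩
    have hst : σ v = Status.star := by
      rcases hv' with h | ⟨C', h1, h2⟩
      · exact h
      · exact absurd h2 (hnot C' h1)
    refine ⟨_, _, ?_, ?_, ?_, h.extend_star (fun h' => hnot C h' hC) (by simp) hC hst
      (by simp [vblSet])⟩
    · simp
    · simp; omega
    · exact vbl_subset_vblSet (Finset.mem_insert_self _ _) hC
  · have hex := hS hne
    have hvS := hv hne
    rw [Exhausted, not_and_or] at hex
    rcases hex with hex | hex
    · exact absurd hB hex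
    push Not at hex
    obtain ⟨C, hCR, u, huC, hus, huR⟩ := hex
    rw [Finset.insert_eq_self.2 hvS] at hCR huR
    have hCS : C ∉ S := fun h' => huR (vbl_subset_vblSet h' huC)
    refine ⟨insert C S, insert u U, ?_, ?_, vblSet_mono (Finset.subset_insert _ _) hvS,
      h.extend_star (fun hb => hCS (hB C hb ?_)) ?_ huC hus huR⟩
    · rw [Finset.card_insert_of_notMem hCS]; omega
    · have := Finset.card_insert_le C S
      omega
    · rwa [Finset.insert_eq_self.2 hvS]
    · intro _ _
      obtain ⟨w, hw⟩ := hCR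
      obtain ⟨C', hC', hw'⟩ := Finset.mem_biUnion.1 (Finset.mem_inter.1 hw).2
      exact ⟨C', hC', touch_of_mem hw' (Finset.mem_inter.1 hw).1⟩

/-- If no small set is exhausted, the exploration reaches a set of prescribed size. -/
theorem exists_explored {σ : PAssign n} {v : Fin n} {L : ℝ} (hL : 0 ≤ L)
    (hv' : σ v = Status.star ∨ ∃ C ∈ blocked Φ ξ σ, v ∈ vbl Φ C)
    (hvC : ∃ C, v ∈ vbl Φ C)
    (hS : ∀ S : Finset (Fin m), Linked Φ S → v ∈ vblSet Φ S → (S.card : ℝ) ≤ L →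
      ¬ Exhausted Φ ξ σ v S) :
    ∃ S U, Explored Φ ξ σ S U ∧ L < (S.card : ℝ) ∧
      (S.card : ℝ) ≤ L + (k + 1 + (Csep Φ ξ).card) := by
  set F := Finset.univ.filter fun S : Finset (Fin m) =>
    (∃ U, Explored Φ ξ σ S U) ∧ (S.Nonempty → v ∈ vblSet Φ S) ∧ (S.card : ℝ) ≤ L with hF
  have hne : F.Nonempty := ⟨∅, by simpa [hF, hL] using ⟨∅, explored_empty σ⟩⟩
  -- Among the explored sets with at most L clauses a largest one is chosen. Its extension must
  -- exceed L, and by no more than the size of one step.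
  obtain ⟨S, hSF, hmax⟩ := Finset.exists_max_image F Finset.card hne
  obtain ⟨⟨U, hU⟩, hvS, hcard⟩ := (Finset.mem_filter.1 hSF).2
  obtain ⟨S', U', h1, h2, h3, h4⟩ := hU.exists_extension hvS hv' hvC
    fun hne => hS S hU.linked (hvS hne) hcard
  have h2' : (S'.card : ℝ) ≤ S.card + (k + 1 + (Csep Φ ξ).card) := by exact_mod_cast h2
  refine ⟨S', U', h4, ?_, by linarith⟩
  by_contra! hle
  have := hmax S' (by
    simp only [hF, Finset.mem_filter, Finset.mem_univ, true_and]
    exact ⟨⟨U', h4⟩, fun _ => h3, hle⟩)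
  omega

/-! ### Numerical consequences of the parameter ranges -/

theorem twenty_le_logb {x : ℝ} (hx : 2 ^ 20 ≤ x) : 20 ≤ Real.logb 2 x := by
  rw [Real.le_logb_iff_rpow_le (by norm_num) (by linarith [hx, show (0:ℝ) < 2 ^ 20 by norm_num])]
  have : (2 : ℝ) ^ (20 : ℝ) = 2 ^ 20 := by
    rw [← Real.rpow_natCast]; norm_num
  rw [this]; exact hx

/-- The function log x/√x decreases beyond e², and at 2²⁰ it equals 20/2¹⁰. -/
theorem logb_le_mul_sqrt {x : ℝ} (hx : 2 ^ 20 ≤ x) :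
    Real.logb 2 x * 2 ^ 10 ≤ 20 * Real.sqrt x := by
  have hexp : Real.exp 2 ≤ 2 ^ 20 := by
    have h1 : Real.exp 2 = Real.exp 1 * Real.exp 1 := by rw [← Real.exp_add]; norm_num
    have h2 := Real.exp_one_lt_d9
    have h3 := Real.exp_pos 1
    rw [h1]
    nlinarith
  have h := Real.log_div_sqrt_antitoneOn (a := 2 ^ 20) (b := x) hexp (hexp.trans hx) hx
  simp only at h
  have hx0 : 0 < x := lt_of_lt_of_le (by norm_num) hx
  have hs : Real.sqrt (2 ^ 20) = 2 ^ 10 := by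
    rw [show (2 : ℝ) ^ 20 = (2 ^ 10) ^ 2 by norm_num]
    exact Real.sqrt_sq (by positivity)
  have hsx : 0 < Real.sqrt x := Real.sqrt_pos.2 hx0
  rw [hs, Real.log_pow, div_le_div_iff₀ hsx (by norm_num)] at h
  have hl2 : 0 < Real.log 2 := Real.log_pos (by norm_num)
  rw [Real.logb, div_mul_eq_mul_div, div_le_iff₀ hl2]
  push_cast at h
  linarith

theorem logb_le_mul {x : ℝ} (hx : 2 ^ 20 ≤ x) : Real.logb 2 x * 2 ^ 20 ≤ 20 * x := by
  have h := logb_le_mul_sqrt hx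
  have h10 : (2 : ℝ) ^ 10 ≤ Real.sqrt x := by
    apply Real.le_sqrt_of_sq_le
    linarith [hx, show ((2 : ℝ) ^ 10) ^ 2 = 2 ^ 20 by norm_num]
  have hsq : Real.sqrt x * Real.sqrt x = x :=
    Real.mul_self_sqrt (le_trans (by norm_num) hx)
  nlinarith

theorem logb_sq_le {x : ℝ} (hx : 2 ^ 20 ≤ x) : Real.logb 2 x ^ 2 ≤ x := by
  have h := logb_le_mul_sqrt hx
  have h20 := twenty_le_logb hx
  have hsq : Real.sqrt x * Real.sqrt x = x :=
    Real.mul_self_sqrt (le_trans (by norm_num) hx)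
  have h0 := Real.sqrt_nonneg x
  have : Real.logb 2 x ≤ Real.sqrt x := by linarith
  nlinarith

/-- The quantity `2 ^ (k / log k)`. -/
def expScale (k : ℕ) : ℝ := (2 : ℝ) ^ ((k : ℝ) / Real.logb 2 k)

theorem expScale_pow (k i : ℕ) :
    (2 : ℝ) ^ ((i : ℝ) * k / Real.logb 2 k) = expScale k ^ i := by
  rw [expScale, ← Real.rpow_natCast, ← Real.rpow_mul (by norm_num)]
  congr 1
  ring

namespace IsNice

variable {c : ℝ}

theorem k_ge (h : IsNice c Φ ξ) : (2 : ℝ) ^ 20 ≤ k := by exact_mod_cast h.k_large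

theorem k_pos (h : IsNice c Φ ξ) : (0 : ℝ) < k := lt_of_lt_of_le (by norm_num) h.k_ge

theorem le_expScale (h : IsNice c Φ ξ) : (k : ℝ) ≤ expScale k := by
  have h20 := twenty_le_logb h.k_ge
  have hsq := logb_sq_le h.k_ge
  have h1 : (k : ℝ) = (2 : ℝ) ^ Real.logb 2 k :=
    (Real.rpow_logb (by norm_num) (by norm_num) h.k_pos).symm
  have h2 : Real.logb 2 k ≤ (k : ℝ) / Real.logb 2 k := by
    rw [le_div_iff₀ (by linarith)]; nlinarith
  calc (k : ℝ) = (2 : ℝ) ^ Real.logb 2 k := h1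
    _ ≤ expScale k := Real.rpow_le_rpow_of_exponent_le (by norm_num) h2

theorem expScale_pos (_h : IsNice c Φ ξ) : 0 < expScale k := by unfold expScale; positivity

/-- The exponent 20 comes from log k ≥ 20. With 2^k ≤ n it places n above the 20th power of
`expScale k`, far beyond the powers 2 and 5 that occur later. -/
theorem expScale_pow_le (h : IsNice c Φ ξ) : expScale k ^ 20 ≤ (2 : ℝ) ^ k := by
  have h20 := twenty_le_logb h.k_ge
  rw [← expScale_pow k 20, ← Real.rpow_natCast 2 k]
  refine Real.rpow_le_rpow_of_exponent_le (by norm_num) ?_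
  rw [div_le_iff₀ (by linarith)]
  have := h.k_pos
  push_cast
  nlinarith

theorem two_pow_le (h : IsNice 1 Φ ξ) : (2 : ℝ) ^ k ≤ n := by
  have := h.n_large
  rwa [one_mul, Real.rpow_natCast] at this

theorem n_pos (h : IsNice 1 Φ ξ) : (0 : ℝ) < n := lt_of_lt_of_le (by positivity) h.two_pow_le

theorem eta_mul (h : IsNice c Φ ξ) : eta Φ * k = 15 * Real.logb 2 k := by
  have := h.k_pos.ne'
  unfold eta
  field_simp

theorem eta_pos (h : IsNice c Φ ξ) : 0 < eta Φ := by
  have h20 := twenty_le_logb h.k_ge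
  have := h.k_pos
  unfold eta
  positivity

theorem eta_le (h : IsNice c Φ ξ) : eta Φ ≤ 1 / 1000 := by
  have := logb_le_mul h.k_ge
  unfold eta
  rw [div_le_iff₀ h.k_pos]
  have := h.k_pos
  norm_num at this ⊢
  linarith

theorem one_le_eta_mul (h : IsNice c Φ ξ) : 1 ≤ eta Φ * k := by
  rw [h.eta_mul]; linarith [twenty_le_logb h.k_ge]

theorem xi_pos (h : IsNice c Φ ξ) : 0 < ξ := lt_of_lt_of_le (by positivity) h.xi_lower

theorem density_pos (h : IsNice c Φ ξ) : 0 < density Φ :=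
  lt_of_lt_of_le (by have := h.k_pos; positivity) h.density_lower

theorem distinct_vars' (h : IsNice 1 Φ ξ) {S : Finset (Fin m)} (hS : 1 ≤ S.card)
    (hS' : (S.card : ℝ) ≤ n / expScale k ^ 2) :
    (k : ℝ) * S.card / (1 + eta Φ) ≤ (vblSet Φ S).card := by
  refine h.distinct_vars S hS ?_
  have := expScale_pow k 2
  push_cast at this
  rwa [this]

theorem expScale_ge (h : IsNice c Φ ξ) : 2 ^ 20 ≤ expScale k := h.k_ge.trans h.le_expScale

theorem pow_le_n (h : IsNice 1 Φ ξ) : expScale k ^ 20 ≤ n := h.expScale_pow_le.trans h.two_pow_le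

theorem div_two_pow_le (h : IsNice 1 Φ ξ) : (n : ℝ) / (2 : ℝ) ^ (4 * k) ≤ n / expScale k ^ 5 := by
  have hE := h.expScale_ge
  have hE1 : 1 ≤ expScale k := le_trans (by norm_num) hE
  refine div_le_div_of_nonneg_left h.n_pos.le (by have := h.expScale_pos; positivity) ?_
  calc expScale k ^ 5 ≤ expScale k ^ 20 := pow_le_pow_right₀ hE1 (by norm_num)
    _ ≤ 2 ^ k := h.expScale_pow_le
    _ ≤ 2 ^ (4 * k) := pow_le_pow_right₀ (by norm_num) (by omega)

theorem k_succ_le (h : IsNice 1 Φ ξ) : (k : ℝ) + 1 ≤ n / expScale k ^ 5 := by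
  have hE := h.expScale_ge
  have hE0 := h.expScale_pos
  have hE1 : 1 ≤ expScale k := le_trans (by norm_num) hE
  rw [le_div_iff₀ (by positivity)]
  calc ((k : ℝ) + 1) * expScale k ^ 5 ≤ (expScale k ^ 2) * expScale k ^ 5 := by
        gcongr
        have := h.le_expScale
        nlinarith
    _ = expScale k ^ 7 := by ring
    _ ≤ expScale k ^ 20 := pow_le_pow_right₀ hE1 (by norm_num)
    _ ≤ n := h.pow_le_n

theorem three_mul_div_le (h : IsNice 1 Φ ξ) :
    3 * ((n : ℝ) / expScale k ^ 5) ≤ n / expScale k ^ 2 := by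
  have hE := h.expScale_ge
  have hE0 := h.expScale_pos
  have hn := h.n_pos
  rw [← mul_div_assoc, div_le_div_iff₀ (by positivity) (by positivity)]
  have : 3 * (expScale k ^ 2) ≤ expScale k ^ 5 := by
    have h1 : expScale k ^ 5 = expScale k ^ 3 * expScale k ^ 2 := by ring
    rw [h1]
    have h2 : (1 : ℝ) ≤ expScale k ^ 2 := one_le_pow₀ (le_trans (by norm_num) hE)
    have h3 : 3 ≤ expScale k ^ 3 := by
      have : expScale k ^ 3 = expScale k ^ 2 * expScale k := by ring
      rw [this]; nlinarith
    gcongr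
  nlinarith

/-! ### Consequences of expansion for separators and explored sets. -/

theorem card_Csep_le (h : IsNice 1 Φ ξ) : ((Csep Φ ξ).card : ℝ) ≤ n / (2 : ℝ) ^ (4 * k) := by
  refine card_sepState_le h.eta_pos.le h.distinct_vars h.few_high_degree h.one_le_eta_mul ?_ m
  have h2 := expScale_pow k 2
  push_cast at h2
  rw [h2]
  have h3 := h.three_mul_div_le
  have h4 := h.k_succ_le
  have h5 := h.div_two_pow_le
  have := h.k_pos
  linarith

/-- The size reached by the exploration stays in the range of the covering property. -/
theorem explored_size_le (h : IsNice 1 Φ ξ) {L x : ℝ} (hL : L ≤ n / expScale k ^ 5)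
    (hx : x ≤ L + (k + 1 + (Csep Φ ξ).card)) : x ≤ n / expScale k ^ 2 := by
  -- Each of L, k + 1 and the number of separators is at most `n / expScale k ^ 5`, and three such
  -- terms stay below `n / expScale k ^ 2`.
  have h3 := h.three_mul_div_le
  have h4 := h.k_succ_le
  have h5 := h.div_two_pow_le
  have h6 := h.card_Csep_le
  linarith

/-- The clauses next to a small connected set of clauses are few. -/
theorem card_neighbors_le (h : IsNice 1 Φ ξ) (hs : 6 * (k : ℝ) ^ 4 * density Φ * Real.logb 2 n < s)
    (hs' : s ≤ n / expScale k ^ 5) {S : Finset (Fin m)} (hS : Linked Φ S)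
    (hne : (vblSet Φ S).Nonempty) (hcard : (S.card : ℝ) ≤ s / (6 * (k : ℝ) ^ 4 * density Φ))
    {T : Finset (Fin m)} (hT : ∀ C ∈ T, (vbl Φ C ∩ vblSet Φ S).Nonempty) : (T.card : ℝ) < s := by
  have hk := h.k_pos
  have hα := h.density_pos
  have hn := h.n_pos
  have hn1 : (1 : ℝ) < n := lt_of_lt_of_le
    (one_lt_pow₀ (by norm_num) (by have := h.k_large; omega)) h.two_pow_le
  have hlog : 0 < Real.logb 2 n := Real.logb_pos (by norm_num) hn1
  have hs0 : 0 < s := lt_trans (by positivity) hs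
  have hN := h.neighbors _ (hS.variables_connected hne)
  set N := Finset.univ.filter fun v => v ∈ vblSet Φ S ∨
    ∃ u ∈ vblSet Φ S, (variableGraph Φ).Adj v u with hNdef
  -- The 6 in L is twice the 3 of the neighbourhood property, which gives ks/2. The lower bound on s
  -- covers the case where the maximum is the term with k log n.
  have hNs : (N.card : ℝ) ≤ k * s / 2 := by
    refine hN.trans ?_
    have h1 : ((vblSet Φ S).card : ℝ) ≤ k * (s / (6 * (k : ℝ) ^ 4 * density Φ)) := by
      have : ((vblSet Φ S).card : ℝ) ≤ k * S.card := by exact_mod_cast card_vblSet_le Φ S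
      exact this.trans (by gcongr)
    have h2 : ((⌊(k : ℝ) * Real.logb 2 n⌋₊ : ℕ) : ℝ) ≤ k * (s / (6 * (k : ℝ) ^ 4 * density Φ)) := by
      refine (Nat.floor_le (by positivity)).trans ?_
      gcongr
      rw [le_div_iff₀ (by positivity)]
      linarith
    calc 3 * (k : ℝ) ^ 4 * density Φ * _
        ≤ 3 * (k : ℝ) ^ 4 * density Φ * (k * (s / (6 * (k : ℝ) ^ 4 * density Φ))) := by
          gcongr; exact max_le h1 h2
      _ = k * s / 2 := by field_simp; norm_num
  have hVN : vblSet Φ S ⊆ N := fun v hv => Finset.mem_filter.2 ⟨Finset.mem_univ _, Or.inl hv⟩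
  -- A clause meeting `vblSet Φ S` lies entirely in its closed neighbourhood `N`. Property (2) then
  -- leaves at most (1+η)s/2 < s such clauses.
  have hTN : T ⊆ Finset.univ.filter fun C => vbl Φ C ⊆ N := by
    intro C hC
    rw [Finset.mem_filter]
    refine ⟨Finset.mem_univ _, fun v hv => ?_⟩
    obtain ⟨w, hw⟩ := hT C hC
    rw [Finset.mem_inter] at hw
    by_cases hvw : v = w
    · exact hVN (hvw ▸ hw.2)
    · refine Finset.mem_filter.2 ⟨Finset.mem_univ _, Or.inr ⟨w, hw.2, ?_⟩⟩
      rw [variableGraph, SimpleGraph.fromRel_adj]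
      exact ⟨hvw, Or.inl ⟨C, hv, hw.1⟩⟩
  have hE := h.expScale_ge
  have hE0 := h.expScale_pos
  have hkE := h.le_expScale
  have hNle : (N.card : ℝ) ≤ n / (2 : ℝ) ^ ((k : ℝ) / Real.logb 2 k) := by
    refine hNs.trans ?_
    change _ ≤ n / expScale k
    calc (k : ℝ) * s / 2 ≤ expScale k * (n / expScale k ^ 5) := by
          have : (k : ℝ) * s ≤ expScale k * (n / expScale k ^ 5) := by gcongr
          have : 0 ≤ (k : ℝ) * s := by positivity
          linarith
      _ ≤ n / expScale k := by
          rw [← mul_div_assoc, div_le_div_iff₀ (by positivity) hE0]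
          have : expScale k * expScale k ≤ expScale k ^ 5 := by
            calc expScale k * expScale k = expScale k ^ 2 := by ring
              _ ≤ expScale k ^ 5 := pow_le_pow_right₀ (le_trans (by norm_num) hE) (by norm_num)
          nlinarith
  have hin := h.clauses_inside N (Finset.card_pos.2 (hne.mono hVN)) hNle
  have heta := h.eta_le
  have heta0 := h.eta_pos
  have hTc : (T.card : ℝ) ≤ (Finset.univ.filter fun C => vbl Φ C ⊆ N).card := by
    exact_mod_cast Finset.card_le_card hTN
  calc (T.card : ℝ) ≤ (1 + eta Φ) * N.card / k := hTc.trans hin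
    _ ≤ (1 + eta Φ) * (k * s / 2) / k := by gcongr
    _ = (1 + eta Φ) / 2 * s := by field_simp
    _ < s := by nlinarith

/-- Explored sets of clauses contain few separators. -/
theorem sep_fraction (h : IsNice 1 Φ ξ) {σ : PAssign n} {S : Finset (Fin m)} {U : Finset (Fin n)}
    (hS : Explored Φ ξ σ S U) (hlog : Real.logb 2 n ≤ S.card)
    (hcard : (S.card : ℝ) ≤ n / expScale k ^ 2) : k * (S ∩ Csep Φ ξ).card ≤ S.card := by
  have hk := h.k_pos
  have hk20 := h.k_ge
  have heta := h.eta_le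
  have heta0 := h.eta_pos
  rcases Nat.eq_zero_or_pos (S ∩ Csep Φ ξ).card with h0 | h0
  · simp [h0]
  have hSpos : 1 ≤ S.card := h0.trans_le (Finset.card_le_card Finset.inter_subset_left)
  set X := S ∩ Csep Φ ξ with hX
  have hXS : (X.card : ℝ) ≤ S.card := by
    exact_mod_cast Finset.card_le_card Finset.inter_subset_left
  -- The separators of `S` form a closed family, so the construction bounds their variables from
  -- above, while property (3) bounds them from below.
  have h1 := card_vblSet_le_of_closed (Φ := Φ) (ξ := ξ) (X := X) Finset.inter_subset_right
    (fun C hC C' hC' ht => Finset.mem_inter.2 ⟨hS.sep_closed C (Finset.mem_inter.1 hC).1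
      (Finset.mem_inter.1 hC).2 C' hC' ht, hC'⟩)
  have h2 := h.distinct_vars' (S := X) h0 (hXS.trans hcard)
  have h3 := h.distinct_vars' hSpos hcard
  have hdiv : ∀ x : ℝ, 0 ≤ x → k * x * (1 - eta Φ) ≤ k * x / (1 + eta Φ) := by
    intro x hx
    rw [le_div_iff₀ (by linarith)]
    have : 0 ≤ k * x := by positivity
    nlinarith [mul_nonneg this (sq_nonneg (eta Φ))]
  have hvS : (S.card : ℝ) ≤ (vblSet Φ S).card := by
    refine le_trans ?_ h3
    have := hdiv S.card (Nat.cast_nonneg _)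
    have h0 : (0 : ℝ) ≤ S.card := Nat.cast_nonneg _
    have hk1 : 1 ≤ (k : ℝ) * (1 - eta Φ) := by
      have : (2 : ℝ) ^ 20 * (1 - 1 / 1000) ≤ k * (1 - eta Φ) := by gcongr
      linarith
    nlinarith [mul_le_mul_of_nonneg_left hk1 h0]
  have hvne : (vblSet Φ S).Nonempty := by
    rw [← Finset.card_pos]
    have : (1 : ℝ) ≤ (vblSet Φ S).card := le_trans (by exact_mod_cast hSpos) hvS
    exact_mod_cast this
  have h4 := h.high_degree_fraction _ (hS.linked.variables_connected hvne) (hlog.trans hvS)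
  have h5 : ((highVars Φ ξ ∩ vblSet Φ X).card : ℝ) ≤
      ((vblSet Φ S).filter fun v => highDeg Φ ξ ≤ (degree Φ v : ℝ)).card := by
    have : highVars Φ ξ ∩ vblSet Φ X ⊆
        (vblSet Φ S).filter fun v => highDeg Φ ξ ≤ (degree Φ v : ℝ) := by
      intro v hv
      rw [Finset.mem_inter] at hv
      exact Finset.mem_filter.2 ⟨vblSet_mono Finset.inter_subset_left hv.2,
        (Finset.mem_filter.1 hv.1).2⟩
    exact_mod_cast Finset.card_le_card this
  have h6 : ((vblSet Φ S).card : ℝ) / (k : ℝ) ^ 2 ≤ S.card / k := by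
    rw [div_le_div_iff₀ (by positivity) hk]
    have : ((vblSet Φ S).card : ℝ) ≤ k * S.card := by exact_mod_cast card_vblSet_le Φ S
    nlinarith
  have h7 := hdiv X.card (Nat.cast_nonneg _)
  -- The two bounds differ by ηk|X|, which the high-degree variables must make up. By property (10)
  -- there are at most |vbl(S)|/k² ≤ |S|/k of these.
  have h8 : eta Φ * k * X.card ≤ S.card / k := by nlinarith
  have h9 : (X.card : ℝ) ≤ S.card / k := by
    refine le_trans ?_ h8
    have := h.one_le_eta_mul
    have h0 : (0 : ℝ) ≤ X.card := Nat.cast_nonneg _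
    nlinarith
  rw [le_div_iff₀ hk] at h9
  have : ((k * X.card : ℕ) : ℝ) ≤ S.card := by push_cast; linarith
  exact_mod_cast this

/-- Explored sets of clauses contain many accessed variables. -/
theorem accessed_ge (h : IsNice 1 Φ ξ) {σ : PAssign n} {S : Finset (Fin m)} {U : Finset (Fin n)}
    (hS : Explored Φ ξ σ S U) (hcard : (S.card : ℝ) ≤ n / expScale k ^ 2) :
    ((S ∩ (frozen Φ ξ σ ∪ bad Φ ξ σ)).card : ℝ) * (k / 3 - eta Φ * k - 1) ≤
      ((vblSet Φ (S ∩ (frozen Φ ξ σ ∪ bad Φ ξ σ))).filter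
        fun v => σ v ≠ Status.unaccessed).card := by
  have hk := h.k_pos
  have heta := h.eta_le
  have heta0 := h.eta_pos
  set A := S ∩ (frozen Φ ξ σ ∪ bad Φ ξ σ) with hA
  rcases Nat.eq_zero_or_pos A.card with h0 | h0
  · rw [h0]; simp
  have hAS : (A.card : ℝ) ≤ S.card := by
    exact_mod_cast Finset.card_le_card Finset.inter_subset_left
  have h1 := h.distinct_vars' h0 (hAS.trans hcard)
  have h2 := Finset.card_filter_add_card_filter_not (s := vblSet Φ A)
    (fun v => σ v ≠ Status.unaccessed)
  -- An unaccessed variable of `A` lies in a frozen clause of `A`, or it is a separator variable of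
  -- a bad clause. For bad clauses this uses that `S` contains their frozen neighbours.
  have hsub : ((vblSet Φ A).filter fun v => ¬ σ v ≠ Status.unaccessed) ⊆ A.biUnion fun C =>
      if C ∈ frozen Φ ξ σ then vbl Φ C ∩ unassigned σ else vbl Φ C ∩ Vsep Φ ξ := by
    intro w hw
    rw [Finset.mem_filter, not_not] at hw
    obtain ⟨hw, hwu⟩ := hw
    obtain ⟨C, hC, hwC⟩ := Finset.mem_biUnion.1 hw
    rw [Finset.mem_biUnion]
    have key : ∀ C' ∈ A, C' ∈ frozen Φ ξ σ → w ∈ vbl Φ C' → ∃ a ∈ A, w ∈ if a ∈ frozen Φ ξ σ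
        then vbl Φ a ∩ unassigned σ else vbl Φ a ∩ Vsep Φ ξ := by
      intro C' h1 h2 h3
      refine ⟨C', h1, ?_⟩
      rw [if_pos h2]
      exact Finset.mem_inter.2 ⟨h3, mem_unassigned.2 (Or.inr hwu)⟩
    by_cases hCf : C ∈ frozen Φ ξ σ
    · exact key C hC hCf hwC
    · by_cases hws : w ∈ Vsep Φ ξ
      · refine ⟨C, hC, ?_⟩
        rw [if_neg hCf]
        exact Finset.mem_inter.2 ⟨hwC, hws⟩
      · have hCb := (Finset.mem_union.1 (Finset.mem_inter.1 hC).2).resolve_left hCf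
        obtain ⟨C', h1, h2, h3⟩ := hS.bad_closed C (Finset.mem_inter.1 hC).1 hCb w
          (Finset.mem_sdiff.2 ⟨hwC, hws⟩) hwu
        exact key C' (Finset.mem_inter.2 ⟨h1, Finset.mem_union_left _ h2⟩) h2 h3
  -- A frozen clause has fewer than 1 + (2/3 − 2η)k unassigned variables outside `Vsep` and fewer
  -- than 2ηk variables in it. A bad clause contributes only the latter.
  have hterm : ∀ C ∈ A, (((if C ∈ frozen Φ ξ σ then vbl Φ C ∩ unassigned σ
      else vbl Φ C ∩ Vsep Φ ξ).card : ℕ) : ℝ) ≤ 1 + 2 / 3 * k := by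
    intro C hC
    have hsep : C ∉ Csep Φ ξ := by
      rcases Finset.mem_union.1 (Finset.mem_inter.1 hC).2 with h | h
      · exact frozen_not_sep h
      · exact bad_not_sep h
    have h1 := card_inter_Vsep_lt hsep
    split_ifs with hf
    · have h2 := (mem_frozen.1 hf).2.2
      have h3 : vbl Φ C ∩ unassigned σ ⊆
          ((vbl Φ C ∩ unassigned σ) \ Vsep Φ ξ) ∪ (vbl Φ C ∩ Vsep Φ ξ) := by
        intro v hv
        simp only [Finset.mem_union, Finset.mem_sdiff, Finset.mem_inter] at hv ⊢
        tauto
      have h4 : ((vbl Φ C ∩ unassigned σ).card : ℝ) ≤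
          ((vbl Φ C ∩ unassigned σ) \ Vsep Φ ξ).card + (vbl Φ C ∩ Vsep Φ ξ).card := by
        exact_mod_cast (Finset.card_le_card h3).trans (Finset.card_union_le _ _)
      linarith
    · nlinarith
  have h3 : ((((vblSet Φ A).filter fun v => ¬ σ v ≠ Status.unaccessed).card : ℕ) : ℝ) ≤
      A.card * (1 + 2 / 3 * k) := by
    have := (Finset.card_le_card hsub).trans Finset.card_biUnion_le
    calc _ ≤ _ := Nat.cast_le.2 this
      _ ≤ ∑ C ∈ A, (1 + 2 / 3 * (k : ℝ)) := by
        rw [Nat.cast_sum]; exact Finset.sum_le_sum hterm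
      _ = _ := by rw [Finset.sum_const, nsmul_eq_mul]
  have h2' : ((((vblSet Φ A).filter fun v => σ v ≠ Status.unaccessed).card : ℕ) : ℝ) +
    ((vblSet Φ A).filter fun v => ¬ σ v ≠ Status.unaccessed).card = (vblSet Φ A).card := by
    exact_mod_cast h2
  have h4 : k * A.card * (1 - eta Φ) ≤ k * A.card / (1 + eta Φ) := by
    rw [le_div_iff₀ (by linarith)]
    have : 0 ≤ (k : ℝ) * A.card := by positivity
    nlinarith [mul_nonneg this (sq_nonneg (eta Φ))]
  nlinarith

end IsNice

/-! ### Truncated states contain large explored sets -/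

theorem RecNode.star_of_root {σ₀ π : PAssign n} {d : ℕ} (h : RecNode Φ ξ s σ₀ d π) {v : Fin n}
    (hv : σ₀ v = Status.star) : π v = Status.star := by
  induction h with
  | root => exact hv
  | child d π u a _ _ hnext _ ih =>
    rw [Function.update_of_ne, ih]
    rintro rfl
    rw [nextVar_unaccessed hnext] at ih
    cases ih

namespace IsNice

theorem one_le_scale {c : ℝ} (h : IsNice c Φ ξ) : 1 ≤ 6 * (k : ℝ) ^ 4 * density Φ := by
  have hk := h.k_pos
  have hk20 := h.k_ge
  have h1 : 6 * (k : ℝ) ^ 4 * (1 / (k : ℝ) ^ 3) ≤ 6 * (k : ℝ) ^ 4 * density Φ := by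
    gcongr; exact h.density_lower
  have h2 : 6 * (k : ℝ) ^ 4 * (1 / (k : ℝ) ^ 3) = 6 * k := by field_simp
  rw [h2] at h1
  linarith

theorem s_pos (h : IsNice 1 Φ ξ) (hs : 6 * (k : ℝ) ^ 4 * density Φ * Real.logb 2 n < s) :
    0 < s := by
  have hn1 : (1 : ℝ) ≤ n := le_trans (one_le_pow₀ (by norm_num)) h.two_pow_le
  have hlog : 0 ≤ Real.logb 2 n := Real.logb_nonneg (by norm_num) hn1
  have := h.one_le_scale
  exact lt_of_le_of_lt (by positivity) hs

theorem scaled_le (h : IsNice 1 Φ ξ) (hs : 6 * (k : ℝ) ^ 4 * density Φ * Real.logb 2 n < s) :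
    s / (6 * (k : ℝ) ^ 4 * density Φ) ≤ s :=
  div_le_self (h.s_pos hs).le h.one_le_scale

/-- A node of a recursive cost tree at which the overflow procedure is truncated contains a large
explored set of clauses. -/
theorem explored_of_overflow (h : IsNice 1 Φ ξ)
    (hs : 6 * (k : ℝ) ^ 4 * density Φ * Real.logb 2 n < s) (hs' : s ≤ n / expScale k ^ 5)
    {σ₀ π : PAssign n} {v₀ : Fin n} {d : ℕ} (hv₀ : σ₀ v₀ = Status.star)
    (huniq : ∀ v, σ₀ v = Status.star → v = v₀) (hπ : RecNode Φ ξ s σ₀ d π)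
    (hlarge : s < ((Ccon Φ ξ π).card : ℝ)) :
    ∃ S U, Explored Φ ξ π S U ∧ s / (6 * (k : ℝ) ^ 4 * density Φ) < (S.card : ℝ) ∧
      (S.card : ℝ) ≤ n / expScale k ^ 2 := by
  have hk0 : 0 < k := lt_of_lt_of_le (by norm_num) h.k_large
  have hs0 := h.s_pos hs
  have hα := h.density_pos
  have hL : 0 ≤ s / (6 * (k : ℝ) ^ 4 * density Φ) := by positivity
  have hpos : 0 < (Ccon Φ ξ π).card := by
    have := hs0.trans hlarge
    exact_mod_cast this
  obtain ⟨C₀, hC₀⟩ := Finset.card_pos.1 hpos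
  -- If no clause contained the root star, `{v₀}` would absorb all stars and `Ccon` would be empty.
  -- If a small set were exhausted, all of `Ccon` would be next to it and have fewer than s clauses.
  obtain ⟨S, U, h1, h2, h3⟩ := exists_explored (Φ := Φ) (ξ := ξ) (v := v₀) hL
    (Or.inl (hπ.star_of_root hv₀)) (by
      by_contra! hno
      have hdisj : ∀ C, ¬ (vbl Φ C ∩ {v₀}).Nonempty := by
        rintro C ⟨w, hw⟩
        rw [Finset.mem_inter, Finset.mem_singleton] at hw
        exact hno C (hw.2 ▸ hw.1)
      have hR : Absorbing Φ ξ π {v₀} :=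
        ⟨fun C _ hC => absurd hC (hdisj C), fun C hC => absurd hC (hdisj C)⟩
      exact hdisj C₀ (hR.con_inter hk0
        (hπ.stars_subset hk0 huniq (Finset.mem_singleton_self _) hR) hC₀))
    (by
      intro S hS hvS hcard hex
      have hR := hex.absorbing
      rw [Finset.insert_eq_self.2 hvS] at hR
      have := h.card_neighbors_le hs hs' hS ⟨v₀, hvS⟩ hcard (T := Ccon Φ ξ π) fun C hC =>
        hR.con_inter hk0 (hπ.stars_subset hk0 huniq hvS hR) hC
      linarith)
  exact ⟨S, U, h1, h2, h.explored_size_le ((h.scaled_le hs).trans hs') h3⟩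

/-- A large component of a residual formula all of whose clauses are blocked contains a large
explored set of clauses. -/
theorem explored_of_component (h : IsNice 1 Φ ξ)
    (hs : 6 * (k : ℝ) ^ 4 * density Φ * Real.logb 2 n < s) (hs' : s ≤ n / expScale k ^ 5)
    {σ : PAssign n} (hσ : ∀ C, ¬ SatBy Φ σ C → C ∈ blocked Φ ξ σ)
    (hlarge : HasLargeComponent Φ s σ) :
    ∃ S U, Explored Φ ξ σ S U ∧ s / (6 * (k : ℝ) ^ 4 * density Φ) < (S.card : ℝ) ∧
      (S.card : ℝ) ≤ n / expScale k ^ 2 := by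
  have hk0 : 0 < k := lt_of_lt_of_le (by norm_num) h.k_large
  have hs0 := h.s_pos hs
  have hα := h.density_pos
  have hL : 0 ≤ s / (6 * (k : ℝ) ^ 4 * density Φ) := by positivity
  obtain ⟨K, hK⟩ := hlarge
  obtain ⟨C₀, hC₀⟩ := K.nonempty_supp
  have hv₀ : (Φ C₀.1 ⟨0, hk0⟩).1 ∈ vbl Φ C₀.1 := Finset.mem_image_of_mem _ (Finset.mem_univ _)
  set v₀ := (Φ C₀.1 ⟨0, hk0⟩).1
  obtain ⟨S, U, h1, h2, h3⟩ := exists_explored (Φ := Φ) (ξ := ξ) (v := v₀) hL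
    (Or.inr ⟨C₀.1, hσ _ C₀.2, hv₀⟩) ⟨C₀.1, hv₀⟩ (by
      intro S _ hvS hcard hex
      have habs := hex.1
      rw [Finset.insert_eq_self.2 hvS] at habs
      have hC₀S : C₀.1 ∈ S := habs _ (hσ _ C₀.2) ⟨v₀, Finset.mem_inter.2 ⟨hv₀, hvS⟩⟩
      -- All clauses of the residual graph are blocked, so an exhausted `S` swallows every residual
      -- neighbour of its clauses, hence the whole component.
      have hwalk : ∀ a b : {C : Fin m // ¬ SatBy Φ σ C}, (residualGraph Φ σ).Walk a b →
          a.1 ∈ S → b.1 ∈ S := by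
        intro a b p
        induction p with
        | nil => exact id
        | @cons a c b hac _ ih =>
          intro ha
          refine ih (habs _ (hσ _ c.2) ?_)
          rw [residualGraph, SimpleGraph.fromRel_adj] at hac
          rcases hac.2 with ⟨w, hw⟩ | ⟨w, hw⟩ <;> simp only [Finset.mem_inter] at hw
          · exact ⟨w, Finset.mem_inter.2 ⟨hw.1.2, vbl_subset_vblSet ha hw.1.1⟩⟩
          · exact ⟨w, Finset.mem_inter.2 ⟨hw.1.1, vbl_subset_vblSet ha hw.1.2⟩⟩
      have hsub : Subtype.val '' K.supp ⊆ (S : Set (Fin m)) := by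
        rintro _ ⟨C, hC, rfl⟩
        rw [SimpleGraph.ConnectedComponent.mem_supp_iff] at hC hC₀
        obtain ⟨p⟩ := SimpleGraph.ConnectedComponent.exact (hC₀.trans hC.symm)
        exact hwalk _ _ p hC₀S
      have hle := Set.ncard_le_ncard hsub (Finset.finite_toSet S)
      rw [Set.ncard_image_of_injective _ Subtype.val_injective, Set.ncard_coe_finset] at hle
      have hle' : (K.supp.ncard : ℝ) ≤ S.card := by exact_mod_cast hle
      have := h.scaled_le hs
      linarith)
  exact ⟨S, U, h1, h2, h.explored_size_le ((h.scaled_le hs).trans hs') h3⟩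

end IsNice

/-! ### Invariants of the main loop -/

/-- The state of the main loop when the variables of `vs` remain to be considered. -/
structure LoopState (Φ : KCNF k n m) (ξ : ℝ) (vs : List (Fin n)) (σ : PAssign n) : Prop where
  node : SimNode Φ ξ σ
  no_star : ∀ v, σ v ≠ Status.star
  -- This bound forces a skipped variable that is unaccessed and no separator into a frozen clause.
  wide : ∀ C, C ∉ Csep Φ ξ → ¬ SatBy Φ σ C → (2 / 3 - 2 * eta Φ) * k ≤
    (((vbl Φ C ∩ unassigned σ) \ Vsep Φ ξ).card : ℝ)
  processed : ∀ w, w ∉ vs → σ w ≠ Status.unaccessed ∨ w ∈ Vsep Φ ξ ∨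
    ∃ C ∈ frozen Φ ξ σ, w ∈ vbl Φ C
  sorted : vs.Pairwise (· < ·)

namespace LoopState

variable {vs : List (Fin n)} {σ : PAssign n} {v : Fin n}

theorem processed_not_alive (h : LoopState Φ ξ vs σ) {w : Fin n} (hw : w ∉ vs) :
    w ∉ alive Φ ξ σ := by
  intro hal
  have hal' := mem_alive.1 hal
  rcases h.processed w hw with h1 | h1 | ⟨C, hC, hwC⟩
  · exact h1 hal'.1
  · exact hal'.2.1 h1
  · exact not_mem_vbl_of_frozen hal hC hwC

theorem leastVar_alive (h : LoopState Φ ξ (v :: vs) σ) (hv : v ∈ alive Φ ξ σ) :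
    leastVar (alive Φ ξ σ) = some v := by
  have hne : (alive Φ ξ σ).Nonempty := ⟨v, hv⟩
  rw [leastVar, dif_pos hne]
  congr 1
  refine le_antisymm (Finset.min'_le _ _ hv) (Finset.le_min' _ _ _ fun w hw => ?_)
  by_contra! hlt
  refine h.processed_not_alive ?_ hw
  intro hmem
  rcases List.mem_cons.1 hmem with rfl | hmem
  · exact lt_irrefl _ hlt
  · exact absurd ((List.pairwise_cons.1 h.sorted).1 w hmem) (not_lt.2 hlt.le)

/-- If `v` is unaccessed and no separator, some clause violates its aliveness. By `wide` the clause
is above the threshold with `v` and below it without `v`, so it contains `v` and is frozen. -/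
theorem skip (h : LoopState Φ ξ (v :: vs) σ) (hv : v ∉ alive Φ ξ σ) : LoopState Φ ξ vs σ where
  node := h.node
  no_star := h.no_star
  wide := h.wide
  sorted := (List.pairwise_cons.1 h.sorted).2
  processed w hw := by
    by_cases hwv : w = v
    · subst hwv
      by_contra! hcon
      obtain ⟨h1, h2, h3⟩ := hcon
      rw [mem_alive] at hv
      push Not at hv
      obtain ⟨C, hC, hsat, hlt⟩ := hv h1 h2
      have hwide := h.wide C hC hsat
      rw [sdiff_union_singleton_eq_erase] at hlt
      have hmem : w ∈ (vbl Φ C ∩ unassigned σ) \ Vsep Φ ξ := by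
        by_contra hnot
        rw [Finset.erase_eq_of_notMem hnot] at hlt
        linarith
      have hcard : ((((vbl Φ C ∩ unassigned σ) \ Vsep Φ ξ).erase w).card : ℝ) + 1 =
        ((vbl Φ C ∩ unassigned σ) \ Vsep Φ ξ).card := by
        exact_mod_cast Finset.card_erase_add_one hmem
      refine h3 C (mem_frozen.2 ⟨hsat, hC, by linarith⟩) ?_
      exact (Finset.mem_inter.1 (Finset.mem_sdiff.1 hmem).1).1
    · exact h.processed w (by simp [hwv, hw])

theorem assign (h : LoopState Φ ξ (v :: vs) σ) (hv : v ∈ alive Φ ξ σ) (b : Bool) :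
    LoopState Φ ξ vs (Function.update σ v (Status.bit b)) where
  node := SimNode.child σ v _ h.node h.no_star (h.leastVar_alive hv) (by simp)
  no_star w := by
    by_cases hwv : w = v
    · subst hwv; simp
    · rw [Function.update_of_ne hwv]; exact h.no_star w
  sorted := (List.pairwise_cons.1 h.sorted).2
  wide C hC hsat := by
    have hv' := mem_alive.1 hv
    have hsat' : ¬ SatBy Φ σ C := by
      rintro ⟨j, hj⟩
      refine hsat ⟨j, ?_⟩
      rw [Function.update_of_ne, hj]
      intro heq
      rw [heq, hv'.1] at hj
      cases hj
    refine ((hv'.2.2 C hC).resolve_left hsat').trans ?_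
    refine Nat.cast_le.2 (Finset.card_le_card ?_)
    intro w hw
    simp only [Finset.mem_sdiff, Finset.mem_inter, Finset.mem_union, Finset.mem_singleton,
      not_or, mem_unassigned] at hw ⊢
    rw [Function.update_of_ne hw.2.2]
    exact ⟨hw.1, hw.2.1⟩
  processed w hw := by
    by_cases hwv : w = v
    · subst hwv; left; simp
    · rw [Function.update_of_ne hwv]
      rcases h.processed w (by simp [hwv, hw]) with h1 | h1 | ⟨C, hC, hwC⟩
      · exact Or.inl h1
      · exact Or.inr (Or.inl h1)
      · exact Or.inr (Or.inr ⟨C, frozen_mono hv _ hC, hwC⟩)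

theorem recursing (h : LoopState Φ ξ (v :: vs) σ) (hv : v ∈ alive Φ ξ σ) :
    RecursingNode Φ ξ (Function.update σ v Status.star) :=
  ⟨SimNode.child σ v _ h.node h.no_star (h.leastVar_alive hv) (by simp), v, by simp⟩

/-- When no variable remains, every unaccessed non-separator variable is in a frozen clause, which
is the defining condition of a bad clause. -/
theorem blocked_of_not_sat (h : LoopState Φ ξ [] σ) (C : Fin m) (hC : ¬ SatBy Φ σ C) :
    C ∈ blocked Φ ξ σ := by
  by_cases hs : C ∈ Csep Φ ξ
  · exact Finset.mem_union_right _ hs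
  by_cases hf : C ∈ frozen Φ ξ σ
  · exact frozen_subset_blocked hf
  refine Finset.mem_union_left _ (Finset.mem_union_right _ (mem_bad.2 ⟨hC, ?_, ?_⟩))
  · simp [hs, hf]
  · intro w hw hwu
    rcases h.processed w (by simp) with h1 | h1 | h1
    · exact absurd hwu h1
    · exact absurd h1 (Finset.mem_sdiff.1 hw).2
    · exact h1

end LoopState

theorem IsNice.loopState_init {c : ℝ} (h : IsNice c Φ ξ) :
    LoopState Φ ξ (List.finRange n) fun _ => Status.unaccessed where
  node := SimNode.root
  no_star := by simp
  wide C hC _ := by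
    have h1 := card_inter_Vsep_lt hC
    have h2 := h.width C
    have h3 : vbl Φ C ∩ unassigned (fun _ => Status.unaccessed) = vbl Φ C :=
      Finset.inter_eq_left.2 fun v _ => mem_unassigned.2 (Or.inr rfl)
    have h4 : ((vbl Φ C \ Vsep Φ ξ).card : ℝ) + (vbl Φ C ∩ Vsep Φ ξ).card = (vbl Φ C).card := by
      exact_mod_cast Finset.card_sdiff_add_card_inter (vbl Φ C) (Vsep Φ ξ)
    have h5 := h.k_ge
    rw [h3]
    linarith
  processed w hw := absurd (List.mem_finRange w) hw
  sorted := List.pairwise_lt_finRange n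

/-! ### One-step analysis of the sampler -/

theorem toReal_bind_apply {α β : Type*} [Fintype α] (p : PMF α) (f : α → PMF β) (b : β) :
    ((p.bind f) b).toReal = ∑ a, (p a).toReal * (f a b).toReal := by
  rw [PMF.bind_apply, tsum_fintype, ENNReal.toReal_sum]
  · simp only [ENNReal.toReal_mul]
  · intro a _
    exact ENNReal.mul_ne_top (p.apply_ne_top a) ((f a).apply_ne_top b)

theorem sum_toReal_eq_one {α : Type*} [Fintype α] (p : PMF α) : ∑ a, (p a).toReal = 1 := by
  have h := p.tsum_coe
  rw [tsum_fintype] at h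
  rw [← ENNReal.toReal_sum fun a _ => p.apply_ne_top a, h, ENNReal.toReal_one]

theorem bern_true_toReal {x : ℝ} (h0 : 0 ≤ x) (h1 : x ≤ 1) : (bern x true).toReal = x := by
  have : clampUnit x = x.toNNReal := min_eq_left (by simpa using h1)
  simp [bern, this, h0]

theorem bern_false_toReal {x : ℝ} (h0 : 0 ≤ x) (h1 : x ≤ 1) : (bern x false).toReal = 1 - x := by
  have h := sum_toReal_eq_one (bern x)
  rw [Fintype.sum_bool, bern_true_toReal h0 h1] at h
  linarith

theorem tau_none_toReal (h0 : 0 ≤ delta Φ ξ) (h1 : delta Φ ξ ≤ 1) :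
    (tau Φ ξ none).toReal = delta Φ ξ := by
  rw [tau, toReal_bind_apply, Fintype.sum_bool, bern_true_toReal h0 h1]
  simp [PMF.map_apply]

theorem tau_some_toReal (h0 : 0 ≤ delta Φ ξ) (h1 : delta Φ ξ ≤ 1) (b : Bool) :
    (tau Φ ξ (some b)).toReal = (1 - delta Φ ξ) / 2 := by
  rw [tau, toReal_bind_apply, Fintype.sum_bool, bern_false_toReal h0 h1]
  cases b <;> simp [PMF.map_apply, div_eq_mul_inv]

theorem marginOverflow_of_large {σ : PAssign n} {v : Fin n} (h : s < ((Ccon Φ ξ σ).card : ℝ)) :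
    marginOverflow Φ ξ s σ v = PMF.pure none := by
  rw [marginOverflow, if_pos h]

theorem marginOverflow_of_none {σ : PAssign n} {v : Fin n} (h : ¬ s < ((Ccon Φ ξ σ).card : ℝ))
    (hu : nextVar Φ ξ σ = none) :
    marginOverflow Φ ξ s σ v = (bernoulliFactory Φ ξ σ v).map some := by
  rw [marginOverflow, if_neg h]
  split
  · rfl
  · rename_i u hu'
    rw [hu] at hu'
    cases hu'

theorem marginOverflow_of_some {σ : PAssign n} {v u : Fin n}
    (h : ¬ s < ((Ccon Φ ξ σ).card : ℝ)) (hu : nextVar Φ ξ σ = some u) :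
    marginOverflow Φ ξ s σ v = (tau Φ ξ).bind fun a =>
        match a with
        | some b => marginOverflow Φ ξ s (Function.update σ u (Status.bit b)) v
        | none =>
          (marginOverflow Φ ξ s (Function.update σ u Status.star) u).bind fun r =>
            match r with
            | none => PMF.pure none
            | some b => marginOverflow Φ ξ s (Function.update σ u (Status.bit b)) v := by
  rw [marginOverflow, if_neg h]
  split
  · rename_i hu'
    rw [hu] at hu'
    cases hu'
  · rename_i u' hu'
    rw [hu] at hu'
    cases hu'
    rfl

/-- A nonnegative function of partial assignments that is a supermartingale when a variable is
assigned a bit, and grows by at most a factor `1 + δ` when all three outcomes are counted. -/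
structure IsPotential (δ : ℝ) (Ψ : PAssign n → ℝ) : Prop where
  nonneg : ∀ π, 0 ≤ Ψ π
  -- The weight of a bit is (1−δ)/2 from τ plus δ times the chance that a recursive call returns it,
  -- hence at most (1+δ)/2. The total may be below 1 because calls can halt.
  bits : ∀ (π : PAssign n) (u : Fin n), π u = Status.unaccessed → ∀ w : Bool → ℝ, (∀ b, 0 ≤ w b) →
    (∀ b, w b ≤ (1 + δ) / 2) → w true + w false ≤ 1 →
    w true * Ψ (Function.update π u (Status.bit true)) +
      w false * Ψ (Function.update π u (Status.bit false)) ≤ Ψ π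
  all : ∀ (π : PAssign n) (u : Fin n), π u = Status.unaccessed → ∀ w : Bool → ℝ, (∀ b, 0 ≤ w b) →
    (∀ b, w b ≤ (1 + δ) / 2) → w true + w false ≤ 1 →
    w true * Ψ (Function.update π u (Status.bit true)) +
      w false * Ψ (Function.update π u (Status.bit false)) +
      δ * Ψ (Function.update π u Status.star) ≤ (1 + δ) * Ψ π
  star : ∀ (π : PAssign n) (u : Fin n), π u = Status.unaccessed →
    δ * Ψ (Function.update π u Status.star) ≤ Ψ π

theorem IsPotential.sum {δ : ℝ} {ι : Type*} (I : Finset ι) (a : ι → ℝ) (g : ι → PAssign n → ℝ)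
    (ha : ∀ i ∈ I, 0 ≤ a i) (hg : ∀ i ∈ I, IsPotential δ (g i)) :
    IsPotential δ fun π => ∑ i ∈ I, a i * g i π where
  nonneg π := Finset.sum_nonneg fun i hi => mul_nonneg (ha i hi) ((hg i hi).nonneg π)
  bits π u hu w h1 h2 h3 := by
    rw [Finset.mul_sum, Finset.mul_sum, ← Finset.sum_add_distrib]
    refine Finset.sum_le_sum fun i hi => ?_
    have := mul_le_mul_of_nonneg_left ((hg i hi).bits π u hu w h1 h2 h3) (ha i hi)
    linarith
  all π u hu w h1 h2 h3 := by
    rw [Finset.mul_sum, Finset.mul_sum, Finset.mul_sum, Finset.mul_sum,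
      ← Finset.sum_add_distrib, ← Finset.sum_add_distrib]
    refine Finset.sum_le_sum fun i hi => ?_
    have := mul_le_mul_of_nonneg_left ((hg i hi).all π u hu w h1 h2 h3) (ha i hi)
    linarith
  star π u hu := by
    rw [Finset.mul_sum]
    refine Finset.sum_le_sum fun i hi => ?_
    have := mul_le_mul_of_nonneg_left ((hg i hi).star π u hu) (ha i hi)
    linarith

/-- The overflow procedure at a node of a recursive cost tree is truncated with probability at
most the potential, up to a factor `1 + δ` for each remaining level of the tree. -/
theorem marginOverflow_halt_le (h0 : 0 ≤ delta Φ ξ) (h1 : delta Φ ξ ≤ 1) {Ψ : PAssign n → ℝ}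
    (hΨ : IsPotential (delta Φ ξ) Ψ) {σ₀ : PAssign n} {D : ℕ}
    (hleaf : ∀ d π, RecNode Φ ξ s σ₀ d π → s < ((Ccon Φ ξ π).card : ℝ) → 1 ≤ Ψ π)
    (hdepth : ∀ d π, RecNode Φ ξ s σ₀ d π → d ≤ D) (N : ℕ) :
    ∀ (π : PAssign n) (v : Fin n) (d : ℕ), numUnaccessed π < N → RecNode Φ ξ s σ₀ d π →
      (marginOverflow Φ ξ s π v none).toReal ≤ (1 + delta Φ ξ) ^ (D - d) * Ψ π := by
  induction N with
  | zero => intro π v d hN; omega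
  | succ N ih =>
    intro π v d hN hπ
    have hone : (1 : ℝ) ≤ (1 + delta Φ ξ) ^ (D - d) := one_le_pow₀ (by linarith)
    by_cases hl : s < ((Ccon Φ ξ π).card : ℝ)
    · rw [marginOverflow_of_large hl]
      have := hleaf d π hπ hl
      simp only [PMF.pure_apply, if_true, ENNReal.toReal_one]
      nlinarith
    cases hu : nextVar Φ ξ π with
    | none =>
      rw [marginOverflow_of_none hl hu]
      have : (PMF.map some (bernoulliFactory Φ ξ π v)) none = 0 := by simp [PMF.map_apply]
      rw [this]
      have := hΨ.nonneg π
      simp only [ENNReal.toReal_zero]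
      positivity
    | some u =>
      have huu := nextVar_unaccessed hu
      have hchild : ∀ a : Status, a ≠ Status.unaccessed →
          RecNode Φ ξ s σ₀ (d + 1) (Function.update π u a) := fun a ha =>
        RecNode.child d π u a hπ (not_lt.1 hl) hu ha
      have hsize : ∀ a : Status, a ≠ Status.unaccessed →
          numUnaccessed (Function.update π u a) < N := fun a ha => by
        have := numUnaccessed_update_lt huu ha
        omega
      have hih : ∀ (a : Status), a ≠ Status.unaccessed → ∀ v',
          (marginOverflow Φ ξ s (Function.update π u a) v' none).toReal ≤
            (1 + delta Φ ξ) ^ (D - (d + 1)) * Ψ (Function.update π u a) := fun a ha v' =>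
        ih _ v' _ (hsize a ha) (hchild a ha)
      have hd := hdepth _ _ (hchild Status.star (by simp))
      have hpow : (1 + delta Φ ξ) ^ (D - d) =
          (1 + delta Φ ξ) ^ (D - (d + 1)) * (1 + delta Φ ξ) := by
        rw [← pow_succ]; congr 1; omega
      have hr := sum_toReal_eq_one (marginOverflow Φ ξ s (Function.update π u Status.star) u)
      rw [Fintype.sum_option, Fintype.sum_bool] at hr
      rw [marginOverflow_of_some hl hu, toReal_bind_apply, Fintype.sum_option, Fintype.sum_bool,
        tau_none_toReal h0 h1, tau_some_toReal h0 h1, tau_some_toReal h0 h1]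
      simp only
      rw [toReal_bind_apply, Fintype.sum_option, Fintype.sum_bool]
      simp only [PMF.pure_apply, if_true, ENNReal.toReal_one, mul_one]
      set r : Bool → ℝ := fun b =>
        (marginOverflow Φ ξ s (Function.update π u Status.star) u (some b)).toReal with hrdef
      have hr0 : ∀ b, 0 ≤ r b := fun b => ENNReal.toReal_nonneg
      have hh0 : 0 ≤ (marginOverflow Φ ξ s (Function.update π u Status.star) u none).toReal :=
        ENNReal.toReal_nonneg
      change _ + (r true + r false) = 1 at hr
      change delta Φ ξ * (_ + (r true * _ + r false * _)) + _ ≤ _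
      -- A bit drawn from τ and a bit returned after a star lead to the same child, so the two
      -- probabilities are added before the potential inequality is applied.
      have hall := hΨ.all π u huu (fun b => (1 - delta Φ ξ) / 2 + delta Φ ξ * r b)
        (fun b => by have := hr0 b; have : 0 ≤ 1 - delta Φ ξ := by linarith
                     positivity)
        (fun b => by
          have : r b ≤ 1 := by
            have := hr0 true; have := hr0 false
            cases b <;> linarith
          nlinarith)
        (by nlinarith)
      have ht := hih (Status.bit true) (by simp) v
      have hf := hih (Status.bit false) (by simp) v
      have hs := hih Status.star (by simp) u
      set p := (1 + delta Φ ξ) ^ (D - (d + 1))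
      have hp : 0 ≤ p := by positivity
      rw [hpow]
      have e1 : ∀ b, 0 ≤ (1 - delta Φ ξ) / 2 + delta Φ ξ * r b := fun b => by
        have := hr0 b
        have : 0 ≤ 1 - delta Φ ξ := by linarith
        positivity
      have m1 := mul_le_mul_of_nonneg_left ht (e1 true)
      have m2 := mul_le_mul_of_nonneg_left hf (e1 false)
      have m3 := mul_le_mul_of_nonneg_left hs h0
      have m4 := mul_le_mul_of_nonneg_left hall hp
      linarith

theorem numUnaccessed_add_le {σ₀ π : PAssign n} {d : ℕ} (h : RecNode Φ ξ s σ₀ d π) :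
    numUnaccessed π + d ≤ n := by
  induction h with
  | root =>
    rw [Nat.add_zero]
    exact (Finset.card_le_univ _).trans (Fintype.card_fin n).le
  | child d π u a _ _ hnext ha ih =>
    have := numUnaccessed_update_lt (nextVar_unaccessed hnext) ha
    omega

theorem RecNode.le_recDepth {σ₀ π : PAssign n} {d : ℕ} (h : RecNode Φ ξ s σ₀ d π)
    (hσ₀ : RecursingNode Φ ξ σ₀) : d ≤ recDepth Φ ξ s := by
  refine le_csSup ⟨n, ?_⟩ ⟨σ₀, π, hσ₀, h⟩
  rintro d' ⟨σ', π', _, h'⟩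
  have := numUnaccessed_add_le h'
  omega

/-- The final phase of the sampler, after the main loop. -/
def finalPhase (Φ : KCNF k n m) (s : ℝ) : Option (PAssign n) → PMF (Outcome n)
  | none => PMF.pure Outcome.halted
  | some σ =>
    if HasLargeComponent Φ s σ then PMF.pure Outcome.halted else rejectionSampling Φ σ

theorem solutionSampling_eq : solutionSampling Φ ξ s =
    (sampleLoop Φ ξ s (List.finRange n) fun _ => Status.unaccessed).bind (finalPhase Φ s) := by
  unfold solutionSampling
  congr 1

theorem rejectionSampling_halted (σ : PAssign n) :
    rejectionSampling Φ σ Outcome.halted = 0 := by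
  unfold rejectionSampling
  split <;> simp [PMF.map_apply]

/-- The truncation probability of the main loop and the final phase. -/
theorem sampleLoop_halt_le (h0 : 0 ≤ delta Φ ξ) (h1 : delta Φ ξ ≤ 1) {Ψ : PAssign n → ℝ}
    (hΨ : IsPotential (delta Φ ξ) Ψ)
    (hleaf : ∀ (σ : PAssign n) (v : Fin n) (d : ℕ) (π : PAssign n),
      RecursingNode Φ ξ (Function.update σ v Status.star) → (∀ w, σ w ≠ Status.star) →
      RecNode Φ ξ s (Function.update σ v Status.star) d π → s < ((Ccon Φ ξ π).card : ℝ) → 1 ≤ Ψ π)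
    (hfinal : ∀ σ, LoopState Φ ξ [] σ → HasLargeComponent Φ s σ → 1 ≤ Ψ σ)
    (vs : List (Fin n)) : ∀ σ, LoopState Φ ξ vs σ →
      (((sampleLoop Φ ξ s vs σ).bind (finalPhase Φ s)) Outcome.halted).toReal ≤
        (vs.length * (1 + delta Φ ξ) ^ recDepth Φ ξ s + 1) * Ψ σ := by
  induction vs with
  | nil =>
    intro σ hσ
    rw [sampleLoop, PMF.pure_bind]
    unfold finalPhase
    simp only
    split_ifs with hl
    · have := hfinal σ hσ hl
      simpa using this
    · rw [rejectionSampling_halted]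
      have := hΨ.nonneg σ
      simpa using this
  | cons v vs ih =>
    intro σ hσ
    have hΨσ := hΨ.nonneg σ
    set P := (1 + delta Φ ξ) ^ recDepth Φ ξ s with hP
    have hP0 : 0 ≤ P := by positivity
    rw [sampleLoop]
    by_cases hv : v ∈ alive Φ ξ σ
    · rw [if_pos hv, PMF.bind_bind, toReal_bind_apply, Fintype.sum_option, Fintype.sum_bool]
      simp only [PMF.pure_bind]
      have hvu := (mem_alive.1 hv).1
      have hnone : ((finalPhase Φ s none) Outcome.halted).toReal = 1 := by
        simp [finalPhase]
      rw [hnone, mul_one]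
      have hover := marginOverflow_halt_le (s := s) h0 h1 hΨ
        (σ₀ := Function.update σ v Status.star) (D := recDepth Φ ξ s)
        (fun d π hπ hl => hleaf σ v d π (hσ.recursing hv) hσ.no_star hπ hl)
        (fun d π hπ => hπ.le_recDepth (hσ.recursing hv)) _
        (Function.update σ v Status.star) v 0 (Nat.lt_succ_self _) RecNode.root
      rw [Nat.sub_zero, ← hP] at hover
      have hsum := sum_toReal_eq_one (marginSample Φ ξ s σ v)
      rw [Fintype.sum_option, Fintype.sum_bool] at hsum
      have hval : ∀ r, (marginSample Φ ξ s σ v r).toReal =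
          delta Φ ξ * (marginOverflow Φ ξ s (Function.update σ v Status.star) v r).toReal +
            (1 - delta Φ ξ) / 2 * ((if r = some true then 1 else 0) +
              (if r = some false then 1 else 0)) := by
        intro r
        rw [marginSample, toReal_bind_apply, Fintype.sum_option, Fintype.sum_bool,
          tau_none_toReal h0 h1, tau_some_toReal h0 h1, tau_some_toReal h0 h1]
        simp only [PMF.pure_apply]
        rcases r with _ | _ | _ <;> simp
      have hle1 : ∀ b, (marginOverflow Φ ξ s (Function.update σ v Status.star) v
          (some b)).toReal ≤ 1 := fun b =>
        ENNReal.toReal_le_of_le_ofReal zero_le_one (by simpa using PMF.coe_le_one _ _)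
      have hn0 : 0 ≤ (marginSample Φ ξ s σ v none).toReal := ENNReal.toReal_nonneg
      have hbits := hΨ.bits σ v hvu (fun b => (marginSample Φ ξ s σ v (some b)).toReal)
        (fun b => ENNReal.toReal_nonneg)
        (fun b => by
          rw [hval]
          have := hle1 b
          cases b <;> simp <;> nlinarith)
        (by linarith)
      have ht := mul_le_mul_of_nonneg_left (ih _ (hσ.assign hv true))
        (ENNReal.toReal_nonneg (a := marginSample Φ ξ s σ v (some true)))
      have hf := mul_le_mul_of_nonneg_left (ih _ (hσ.assign hv false))
        (ENNReal.toReal_nonneg (a := marginSample Φ ξ s σ v (some false)))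
      -- The δ for entering the overflow procedure pays for the star at `v`. Each variable of the
      -- loop therefore adds one term PΨ, and the final phase adds the extra 1.
      have hnone' : (marginSample Φ ξ s σ v none).toReal ≤ P * Ψ σ := by
        rw [hval]
        have hst := hΨ.star σ v hvu
        have := mul_le_mul_of_nonneg_left hover h0
        have := mul_le_mul_of_nonneg_left hst hP0
        simp only [reduceCtorEq, if_false]
        linarith
      have hlen : (0 : ℝ) ≤ vs.length * P + 1 := by positivity
      have := mul_le_mul_of_nonneg_left hbits hlen
      rw [List.length_cons]
      push_cast
      linarith
    · rw [if_neg hv]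
      refine (ih σ (hσ.skip hv)).trans ?_
      rw [List.length_cons]
      push_cast
      nlinarith [mul_nonneg hP0 hΨσ]

/-! ### The potential of a witness -/

/-- The inverse `2 / (1 + 2 δ)` of an upper bound on the weight of an accessed variable. -/
def rate (δ : ℝ) : ℝ := 2 / (1 + 2 * δ)

/-- The contribution of the variable `v` to the potential of a witness: the clauses of `A` must
not be satisfied, and the variables of `U` must be starred. -/
def witnessFactor (Φ : KCNF k n m) (δ : ℝ) (A : Finset (Fin m)) (U : Finset (Fin n)) (v : Fin n) :
    Status → ℝ
  | Status.unaccessed => 1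
  | Status.star => if v ∈ U then δ⁻¹ else if v ∈ vblSet Φ A then rate δ else 1
  | Status.bit b => if v ∈ U then 0 else if v ∈ vblSet Φ A then
      (if ∃ C ∈ A, ∃ j, Φ C j = (v, b) then 0 else rate δ) else 1

/-- The potential of a witness. -/
def witnessPotential (Φ : KCNF k n m) (δ : ℝ) (A : Finset (Fin m)) (U : Finset (Fin n))
    (π : PAssign n) : ℝ :=
  ∏ v, witnessFactor Φ δ A U v (π v)

variable {δ : ℝ} {A : Finset (Fin m)} {U : Finset (Fin n)}

theorem rate_pos (h : 0 < δ) : 0 < rate δ := by unfold rate; positivity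

theorem witnessFactor_nonneg (h : 0 < δ) (v : Fin n) (a : Status) :
    0 ≤ witnessFactor Φ δ A U v a := by
  have := (rate_pos h).le
  cases a <;> simp only [witnessFactor] <;> (try split_ifs) <;> positivity

theorem witnessFactor_spec (h : 0 < δ) (hδ1 : δ ≤ 1) (v : Fin n) {w : Bool → ℝ}
    (h2 : ∀ b, w b ≤ (1 + δ) / 2) (h3 : w true + w false ≤ 1) :
    w true * witnessFactor Φ δ A U v (Status.bit true) +
        w false * witnessFactor Φ δ A U v (Status.bit false) ≤ 1 ∧
      w true * witnessFactor Φ δ A U v (Status.bit true) +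
        w false * witnessFactor Φ δ A U v (Status.bit false) +
        δ * witnessFactor Φ δ A U v Status.star ≤ 1 + δ ∧
      δ * witnessFactor Φ δ A U v Status.star ≤ 1 := by
  have hr := rate_pos h
  have hr1 : rate δ * (1 + 2 * δ) = 2 := by unfold rate; field_simp
  by_cases hU : v ∈ U
  · simp only [witnessFactor, if_pos hU, mul_zero, add_zero, zero_add,
      mul_inv_cancel₀ h.ne']
    exact ⟨zero_le_one, by linarith, le_rfl⟩
  by_cases hA : v ∈ vblSet Φ A
  · have hbits : w true * witnessFactor Φ δ A U v (Status.bit true) +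
        w false * witnessFactor Φ δ A U v (Status.bit false) ≤ (1 + δ) / 2 * rate δ := by
      obtain ⟨C, hC, hvC⟩ := Finset.mem_biUnion.1 hA
      obtain ⟨j, _, hj⟩ := Finset.mem_image.1 hvC
      have hle : ∀ b, w b * witnessFactor Φ δ A U v (Status.bit b) ≤ (1 + δ) / 2 * rate δ := by
        intro b
        refine mul_le_mul (h2 b) ?_ (witnessFactor_nonneg h _ _) (by positivity)
        simp only [witnessFactor, if_neg hU, if_pos hA]
        split_ifs <;> linarith
      have hzero : witnessFactor Φ δ A U v (Status.bit (Φ C j).2) = 0 := by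
        simp only [witnessFactor, if_neg hU, if_pos hA]
        exact if_pos ⟨C, hC, j, by rw [← hj]⟩
      cases hb : (Φ C j).2 <;> rw [hb] at hzero <;> rw [hzero, mul_zero]
      · rw [add_zero]; exact hle true
      · rw [zero_add]; exact hle false
    have hstar : witnessFactor Φ δ A U v Status.star = rate δ := by
      simp only [witnessFactor, if_neg hU, if_pos hA]
    rw [hstar]
    refine ⟨?_, ?_, ?_⟩ <;> nlinarith
  · simp only [witnessFactor, if_neg hU, if_neg hA]
    refine ⟨by linarith, by linarith, ?_⟩
    rw [mul_one]; exact hδ1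

theorem witnessPotential_update {π : PAssign n} {u : Fin n} (hu : π u = Status.unaccessed)
    (a : Status) : witnessPotential Φ δ A U (Function.update π u a) =
      witnessFactor Φ δ A U u a * witnessPotential Φ δ A U π := by
  unfold witnessPotential
  rw [← Finset.mul_prod_erase _ _ (Finset.mem_univ u), ← Finset.mul_prod_erase Finset.univ
    (fun v => witnessFactor Φ δ A U v (π v)) (Finset.mem_univ u), Function.update_self, hu]
  simp only [witnessFactor, one_mul]
  congr 1
  refine Finset.prod_congr rfl fun v hv => ?_
  rw [Function.update_of_ne (Finset.ne_of_mem_erase hv)]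

theorem isPotential_witnessPotential (h : 0 < δ) (hδ1 : δ ≤ 1) :
    IsPotential δ (witnessPotential Φ δ A U) := by
  have hnn : ∀ π : PAssign n, 0 ≤ witnessPotential Φ δ A U π := fun π =>
    Finset.prod_nonneg fun v _ => witnessFactor_nonneg h v _
  refine ⟨hnn, ?_, ?_, ?_⟩
  · intro π u hu w h1 h2 h3
    rw [witnessPotential_update hu, witnessPotential_update hu]
    have := mul_le_mul_of_nonneg_right
      (witnessFactor_spec (Φ := Φ) (A := A) (U := U) h hδ1 u h2 h3).1 (hnn π)
    linarith
  · intro π u hu w h1 h2 h3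
    rw [witnessPotential_update hu, witnessPotential_update hu, witnessPotential_update hu]
    have := mul_le_mul_of_nonneg_right
      (witnessFactor_spec (Φ := Φ) (A := A) (U := U) h hδ1 u h2 h3).2.1 (hnn π)
    linarith
  · intro π u hu
    rw [witnessPotential_update hu]
    have := mul_le_mul_of_nonneg_right
      (witnessFactor_spec (Φ := Φ) (A := A) (U := U) h hδ1 u (w := fun _ => 0)
        (fun _ => by positivity) (by norm_num)).2.2 (hnn π)
    linarith

theorem witnessPotential_unaccessed :
    witnessPotential Φ δ A U (fun _ => Status.unaccessed) = 1 := by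
  simp [witnessPotential, witnessFactor]

theorem witnessPotential_eq {π : PAssign n} (hA : ∀ C ∈ A, ¬ SatBy Φ π C)
    (hU : ∀ u ∈ U, π u = Status.star) :
    witnessPotential Φ δ A U π = δ⁻¹ ^ U.card * rate δ ^
      ((vblSet Φ A).filter (fun v => π v ≠ Status.unaccessed) \ U).card := by
  have hfac : ∀ v, witnessFactor Φ δ A U v (π v) = (if v ∈ U then δ⁻¹ else 1) *
      (if v ∈ (vblSet Φ A).filter (fun v => π v ≠ Status.unaccessed) \ U then rate δ else 1) := by
    intro v
    by_cases hvU : v ∈ U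
    · simp [witnessFactor, hU v hvU, hvU]
    · cases hv : π v with
      | unaccessed => simp [witnessFactor, hvU, hv]
      | star => simp [witnessFactor, hvU, hv]
      | bit b =>
        have hno : ¬ ∃ C ∈ A, ∃ j, Φ C j = (v, b) := by
          rintro ⟨C, hC, j, hj⟩
          exact hA C hC ⟨j, by rw [hj]; exact hv⟩
        simp only [witnessFactor, if_neg hno, Finset.mem_sdiff,
          Finset.mem_filter, hv, hvU, not_false_eq_true, and_true,
          ne_eq, reduceCtorEq, if_false, one_mul]
  unfold witnessPotential
  simp only [hfac]
  rw [Finset.prod_mul_distrib, Finset.prod_ite_mem, Finset.prod_ite_mem, Finset.univ_inter,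
    Finset.univ_inter, Finset.prod_const, Finset.prod_const]

theorem Explored.not_sat {σ : PAssign n} {S : Finset (Fin m)} {C : Fin m}
    (hC : C ∈ S ∩ (frozen Φ ξ σ ∪ bad Φ ξ σ)) : ¬ SatBy Φ σ C := by
  rcases Finset.mem_union.1 (Finset.mem_inter.1 hC).2 with h | h
  · exact (mem_frozen.1 h).1
  · exact (mem_bad.1 h).1

/-- The number of accessed variables guaranteed for each frozen or bad clause. -/
def accessedPerClause (Φ : KCNF k n m) : ℕ := ⌊(k : ℝ) / 3 - eta Φ * k - 1⌋₊

/-- The normalization of the potential of a witness. -/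
def witnessWeight (Φ : KCNF k n m) (δ : ℝ) (A : Finset (Fin m)) (U : Finset (Fin n)) : ℝ :=
  (rate δ * δ) ^ U.card * ((rate δ)⁻¹ ^ accessedPerClause Φ) ^ A.card

theorem witnessWeight_nonneg (h : 0 < δ) : 0 ≤ witnessWeight Φ δ A U := by
  have := rate_pos h
  unfold witnessWeight
  positivity

/-- Accessed variables of `A` that also lie in `U` contribute no `rate` to the potential. The
additional `rate` per star in the weight makes up for this overlap. -/
theorem IsNice.one_le_weight_mul_potential (h : IsNice 1 Φ ξ) (hδ : 0 < δ) (hδ' : δ ≤ 1 / 2)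
    {σ : PAssign n} {S : Finset (Fin m)} (hS : Explored Φ ξ σ S U)
    (hcard : (S.card : ℝ) ≤ n / expScale k ^ 2) :
    1 ≤ witnessWeight Φ δ (S ∩ (frozen Φ ξ σ ∪ bad Φ ξ σ)) U *
      witnessPotential Φ δ (S ∩ (frozen Φ ξ σ ∪ bad Φ ξ σ)) U σ := by
  have hacc := h.accessed_ge hS hcard
  rw [witnessPotential_eq (fun C hC => Explored.not_sat hC) hS.stars]
  set A := S ∩ (frozen Φ ξ σ ∪ bad Φ ξ σ) with hA
  set N := (vblSet Φ A).filter fun v => σ v ≠ Status.unaccessed with hN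
  have hr := rate_pos hδ
  have hr1 : 1 ≤ rate δ := by
    unfold rate
    rw [le_div_iff₀ (by positivity)]
    linarith
  have hk := h.k_pos
  have hnonneg : 0 ≤ (k : ℝ) / 3 - eta Φ * k - 1 := by
    have := h.eta_le
    have := h.k_ge
    nlinarith
  have hM : (accessedPerClause Φ : ℝ) * A.card ≤ N.card := by
    refine le_trans ?_ hacc
    rw [mul_comm]
    exact mul_le_mul_of_nonneg_left (Nat.floor_le hnonneg) (Nat.cast_nonneg _)
  have hM' : accessedPerClause Φ * A.card ≤ (N \ U).card + U.card := by
    have h1 : accessedPerClause Φ * A.card ≤ N.card := by exact_mod_cast hM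
    have h2 := Finset.le_card_sdiff U N
    omega
  unfold witnessWeight
  have heq : (rate δ * δ) ^ U.card * ((rate δ)⁻¹ ^ accessedPerClause Φ) ^ A.card *
      (δ⁻¹ ^ U.card * rate δ ^ (N \ U).card) =
      rate δ ^ ((N \ U).card + U.card) / rate δ ^ (accessedPerClause Φ * A.card) := by
    rw [mul_pow, ← pow_mul, inv_pow, inv_pow, pow_add]
    field_simp
  rw [heq, one_le_div (by positivity)]
  exact pow_le_pow_right₀ hr1 hM'

/-! ### The union bound over witnesses -/

/-- The growth rate `e k² α` of the number of connected sets of clauses. -/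
def growth (Φ : KCNF k n m) : ℝ := Real.exp 1 * (k : ℝ) ^ 2 * density Φ

/-- The price `1 / (k ^ 30 e k² α)` paid by a clause of a witness. -/
def price (Φ : KCNF k n m) : ℝ := 1 / ((k : ℝ) ^ 30 * growth Φ)

/-! ### Sizes of `delta`, `rate` and `price`. -/

namespace IsNice

variable {c : ℝ}

theorem growth_pos (h : IsNice c Φ ξ) : 0 < growth Φ := by
  have := h.k_pos
  have := h.density_pos
  unfold growth
  positivity

theorem price_pos (h : IsNice c Φ ξ) : 0 < price Φ := by
  have := h.k_pos
  have := h.growth_pos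
  unfold price
  positivity

theorem delta_pos (h : IsNice c Φ ξ) : 0 < delta Φ ξ := by
  have := h.k_pos
  have := h.density_pos
  have := h.xi_pos
  unfold delta
  positivity

theorem delta_le (h : IsNice c Φ ξ) : delta Φ ξ ≤ 1 / (k : ℝ) ^ 37 := by
  have hk := h.k_pos
  have hα := h.density_pos
  unfold delta
  rw [div_le_div_iff₀ (by positivity) (by positivity)]
  have h1 := h.density_lower
  rw [div_le_iff₀ (by positivity)] at h1
  have h2 : (k : ℝ) ^ 40 * density Φ = k ^ 37 * (density Φ * k ^ 3) := by ring
  rw [h2, one_mul]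
  calc ξ * (k : ℝ) ^ 37 ≤ 1 * k ^ 37 := by gcongr; exact h.xi_upper
    _ = (k : ℝ) ^ 37 * 1 := by ring
    _ ≤ (k : ℝ) ^ 37 * (density Φ * (k : ℝ) ^ 3) := by gcongr

theorem density_le (h : IsNice c Φ ξ) :
    density Φ * (k : ℝ) ^ 50 ≤ (2 : ℝ) ^ ((k : ℝ) / 3) := by
  have hk := h.k_pos
  have h1 := h.density_upper
  rw [le_div_iff₀ (by positivity)] at h1
  refine h1.trans ?_
  have : 0 < (2 : ℝ) ^ ((k : ℝ) / 3) := by positivity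
  nlinarith [h.xi_upper]

theorem delta_mul_k_le (h : IsNice c Φ ξ) : 2 * delta Φ ξ * k ≤ 1 := by
  have hk := h.k_pos
  have hk20 := h.k_ge
  have h1 := h.delta_le
  have h2 : (k : ℝ) ^ 2 ≤ k ^ 37 := pow_le_pow_right₀ (by linarith) (by norm_num)
  calc 2 * delta Φ ξ * k ≤ 2 * (1 / (k : ℝ) ^ 37) * k := by gcongr
    _ ≤ 2 * (1 / (k : ℝ) ^ 2) * k := by gcongr
    _ = 2 / k := by field_simp
    _ ≤ 1 := by rw [div_le_one hk]; linarith

theorem delta_le_half (h : IsNice c Φ ξ) : delta Φ ξ ≤ 1 / 2 := by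
  have h1 := h.delta_mul_k_le
  have h2 := h.k_ge
  have h3 := h.delta_pos
  nlinarith

/-- About k/3 accessed variables give 2^(−k/3), up to the factor 4k¹⁵ due to η and rounding and a
factor 3 from (1+2δ)^k. The assumption αk⁵⁰ ≤ 2^(k/3) absorbs all of it. -/
theorem rate_inv_pow_le (h : IsNice c Φ ξ) :
    (rate (delta Φ ξ))⁻¹ ^ accessedPerClause Φ ≤ price Φ := by
  have hk := h.k_pos
  have hk20 := h.k_ge
  have hδ := h.delta_pos
  have hα := h.density_pos
  have hη := h.eta_pos
  set M := accessedPerClause Φ with hM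
  have hMk : M ≤ k := by
    rw [hM, accessedPerClause]
    refine Nat.floor_le_of_le ?_
    have : 0 ≤ eta Φ * k := by positivity
    linarith
  have hMlow : (k : ℝ) / 3 - 15 * Real.logb 2 k - 2 ≤ M := by
    have := Nat.sub_one_lt_floor ((k : ℝ) / 3 - eta Φ * k - 1)
    rw [h.eta_mul] at this
    rw [hM, accessedPerClause, h.eta_mul]
    linarith
  have h1 : (rate (delta Φ ξ))⁻¹ ^ M = (1 + 2 * delta Φ ξ) ^ M / 2 ^ M := by
    rw [rate, inv_div, div_pow]
  have h2 : (1 + 2 * delta Φ ξ) ^ M ≤ 3 := by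
    calc (1 + 2 * delta Φ ξ) ^ M ≤ (1 + 2 * delta Φ ξ) ^ k :=
          pow_le_pow_right₀ (by linarith) hMk
      _ ≤ Real.exp (2 * delta Φ ξ) ^ k := by
          gcongr
          linarith [Real.add_one_le_exp (2 * delta Φ ξ)]
      _ = Real.exp (k * (2 * delta Φ ξ)) := (Real.exp_nat_mul _ _).symm
      _ ≤ Real.exp 1 := Real.exp_le_exp.2 (by linarith [h.delta_mul_k_le])
      _ ≤ 3 := by linarith [Real.exp_one_lt_d9]
  have h3 : (2 : ℝ) ^ ((k : ℝ) / 3) / (4 * (k : ℝ) ^ 15) ≤ 2 ^ M := by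
    have hlog : (2 : ℝ) ^ Real.logb 2 k = k := Real.rpow_logb (by norm_num) (by norm_num) hk
    have : (2 : ℝ) ^ ((k : ℝ) / 3 - Real.logb 2 k * (15 : ℕ) - (2 : ℕ)) =
        (2 : ℝ) ^ ((k : ℝ) / 3) / (4 * (k : ℝ) ^ 15) := by
      rw [Real.rpow_sub (by norm_num), Real.rpow_sub (by norm_num), Real.rpow_mul (by norm_num),
        hlog, Real.rpow_natCast, Real.rpow_natCast]
      field_simp
      norm_num
    rw [← this, ← Real.rpow_natCast 2 M]
    refine Real.rpow_le_rpow_of_exponent_le (by norm_num) ?_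
    push_cast
    linarith
  have h4 := h.density_le
  rw [h1, price, growth, div_le_div_iff₀ (by positivity) (by positivity), one_mul]
  refine le_trans ?_ h3
  rw [le_div_iff₀ (by positivity)]
  refine le_trans ?_ h4
  have he : Real.exp 1 ≤ 3 := by linarith [Real.exp_one_lt_d9]
  calc (1 + 2 * delta Φ ξ) ^ M * ((k : ℝ) ^ 30 * (Real.exp 1 * k ^ 2 * density Φ)) *
        (4 * k ^ 15)
      ≤ 3 * ((k : ℝ) ^ 30 * (3 * k ^ 2 * density Φ)) * (4 * k ^ 15) := by gcongr
    _ = density Φ * k ^ 47 * 36 := by ring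
    _ ≤ density Φ * k ^ 47 * k ^ 3 := by
        gcongr
        calc (36 : ℝ) ≤ (2 ^ 20) ^ 3 := by norm_num
          _ ≤ (k : ℝ) ^ 3 := by gcongr
    _ = density Φ * k ^ 50 := by ring

/-- The k⁴⁰ in δ pays the price k³²α (up to e) and a further 1/k. The latter offsets the roughly k
choices of a star per clause. -/
theorem rate_mul_delta_le (h : IsNice c Φ ξ) :
    rate (delta Φ ξ) * delta Φ ξ ≤ price Φ * (1 / k) := by
  have hk := h.k_pos
  have hk20 := h.k_ge
  have hδ := h.delta_pos
  have hα := h.density_pos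
  have hr : rate (delta Φ ξ) ≤ 2 := by
    unfold rate
    rw [div_le_iff₀ (by positivity)]
    linarith
  have he : Real.exp 1 ≤ 3 := by linarith [Real.exp_one_lt_d9]
  have hr0 := rate_pos hδ
  have h1 : rate (delta Φ ξ) * delta Φ ξ ≤ 2 * (1 / ((k : ℝ) ^ 40 * density Φ)) := by
    have : delta Φ ξ ≤ 1 / ((k : ℝ) ^ 40 * density Φ) := by
      unfold delta
      gcongr
      exact h.xi_upper
    gcongr
  refine h1.trans ?_
  rw [price, growth, ← mul_div_assoc, mul_one, div_mul_div_comm, mul_one,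
    div_le_div_iff₀ (by positivity) (by positivity)]
  calc 2 * ((k : ℝ) ^ 30 * (Real.exp 1 * k ^ 2 * density Φ) * k)
      ≤ 2 * ((k : ℝ) ^ 30 * (3 * k ^ 2 * density Φ) * k) := by gcongr
    _ = 6 * (k ^ 33 * density Φ) := by ring
    _ ≤ k ^ 7 * (k ^ 33 * density Φ) := by
        gcongr
        calc (6 : ℝ) ≤ (2 ^ 20) ^ 7 := by norm_num
          _ ≤ (k : ℝ) ^ 7 := by gcongr
    _ = 1 * (k ^ 40 * density Φ) := by ring

/-- Separators carry no weight of their own. Crediting each with 2^k is affordable because they are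
at most one clause in k, for a total loss of 2 per clause. -/
theorem one_le_price_mul (h : IsNice c Φ ξ) : 1 ≤ price Φ * 2 ^ k := by
  have hk := h.k_pos
  have hk20 := h.k_ge
  have hα := h.density_pos
  have he : Real.exp 1 ≤ 3 := by linarith [Real.exp_one_lt_d9]
  rw [price, growth, one_div_mul_eq_div, one_le_div (by positivity)]
  have h1 : (2 : ℝ) ^ ((k : ℝ) / 3) ≤ 2 ^ k := by
    rw [← Real.rpow_natCast 2 k]
    exact Real.rpow_le_rpow_of_exponent_le (by norm_num) (by linarith)
  refine le_trans ?_ (h.density_le.trans h1)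
  calc (k : ℝ) ^ 30 * (Real.exp 1 * k ^ 2 * density Φ)
      ≤ (k : ℝ) ^ 30 * (3 * k ^ 2 * density Φ) := by gcongr
    _ = density Φ * k ^ 32 * 3 := by ring
    _ ≤ density Φ * k ^ 32 * k ^ 18 := by
        gcongr
        calc (3 : ℝ) ≤ (2 ^ 20) ^ 18 := by norm_num
          _ ≤ (k : ℝ) ^ 18 := by gcongr
    _ = density Φ * k ^ 50 := by ring

end IsNice

/-- The connected sets of more than `L` clauses. -/
def connectedSets (Φ : KCNF k n m) (L : ℝ) : Finset (Finset (Fin m)) :=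
  Finset.univ.filter fun S =>
    ((clauseGraph Φ).induce (S : Set (Fin m))).Connected ∧ L < (S.card : ℝ)

/-- The ways of splitting the clauses of `S` that are not separators into unsatisfied clauses and
clauses paid for by a starred variable. -/
def splittings (Φ : KCNF k n m) (ξ : ℝ) (S : Finset (Fin m)) :
    Finset (Finset (Fin m) × Finset (Fin n)) :=
  (S.powerset ×ˢ (vblSet Φ S).powerset).filter fun p =>
    p.1.card + p.2.card + (S ∩ Csep Φ ξ).card = S.card ∧ k * (S ∩ Csep Φ ξ).card ≤ S.card

/-- The witnesses of a truncation. -/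
def witnesses (Φ : KCNF k n m) (ξ L : ℝ) :
    Finset (Σ _ : Finset (Fin m), Finset (Fin m) × Finset (Fin n)) :=
  (connectedSets Φ L).sigma (splittings Φ ξ)

theorem sum_inv_pow_card_le (hk : 0 < k) (S : Finset (Fin m)) :
    ∑ U ∈ (vblSet Φ S).powerset, (1 / (k : ℝ)) ^ U.card ≤ 3 ^ S.card := by
  have hk' : (0 : ℝ) < k := by exact_mod_cast hk
  have h1 := Finset.sum_pow_mul_eq_add_pow (1 / (k : ℝ)) 1 (vblSet Φ S)
  simp only [one_pow, mul_one] at h1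
  rw [h1]
  calc (1 / (k : ℝ) + 1) ^ (vblSet Φ S).card ≤ (1 / (k : ℝ) + 1) ^ (k * S.card) :=
        pow_le_pow_right₀ (by linarith [show 0 < 1 / (k : ℝ) by positivity]) (card_vblSet_le Φ S)
    _ = ((1 / (k : ℝ) + 1) ^ k) ^ S.card := pow_mul _ _ _
    _ ≤ 3 ^ S.card := by
        gcongr
        calc (1 / (k : ℝ) + 1) ^ k ≤ Real.exp (1 / k) ^ k := by
              gcongr; exact Real.add_one_le_exp _
          _ = Real.exp 1 := by rw [← Real.exp_nat_mul]; congr 1; field_simp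
          _ ≤ 3 := by linarith [Real.exp_one_lt_d9]

/-! ### Summation over the witnesses. -/

namespace IsNice

theorem sum_splittings_le {c : ℝ} (h : IsNice c Φ ξ) (S : Finset (Fin m)) :
    ∑ p ∈ splittings Φ ξ S, witnessWeight Φ (delta Φ ξ) p.1 p.2 ≤ (12 * price Φ) ^ S.card := by
  have hk := h.k_pos
  have hδ := h.delta_pos
  have hr := rate_pos hδ
  have hz := h.price_pos
  have hterm : ∀ p ∈ splittings Φ ξ S, witnessWeight Φ (delta Φ ξ) p.1 p.2 ≤
      (2 * price Φ) ^ S.card * (1 / (k : ℝ)) ^ p.2.card := by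
    intro p hp
    obtain ⟨h1, h2⟩ := (Finset.mem_filter.1 hp).2
    calc witnessWeight Φ (delta Φ ξ) p.1 p.2
        ≤ (price Φ * (1 / k)) ^ p.2.card * price Φ ^ p.1.card := by
          unfold witnessWeight
          have := h.rate_mul_delta_le
          have := h.rate_inv_pow_le
          gcongr
      _ = price Φ ^ (p.1.card + p.2.card) * 1 * (1 / (k : ℝ)) ^ p.2.card := by
          rw [mul_pow, pow_add]; ring
      _ ≤ price Φ ^ (p.1.card + p.2.card) * (price Φ * 2 ^ k) ^ (S ∩ Csep Φ ξ).card *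
          (1 / (k : ℝ)) ^ p.2.card := by
          gcongr
          exact one_le_pow₀ h.one_le_price_mul
      _ = price Φ ^ S.card * 2 ^ (k * (S ∩ Csep Φ ξ).card) * (1 / (k : ℝ)) ^ p.2.card := by
          rw [mul_pow, ← pow_mul, ← mul_assoc, ← pow_add, h1]
      _ ≤ price Φ ^ S.card * 2 ^ S.card * (1 / (k : ℝ)) ^ p.2.card := by
          gcongr
          norm_num
      _ = (2 * price Φ) ^ S.card * (1 / (k : ℝ)) ^ p.2.card := by rw [mul_pow]; ring
  refine (Finset.sum_le_sum hterm).trans ?_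
  have hk0 : 0 < k := by exact_mod_cast hk
  calc ∑ p ∈ splittings Φ ξ S, (2 * price Φ) ^ S.card * (1 / (k : ℝ)) ^ p.2.card
      ≤ ∑ p ∈ S.powerset ×ˢ (vblSet Φ S).powerset,
          (2 * price Φ) ^ S.card * (1 / (k : ℝ)) ^ p.2.card :=
        Finset.sum_le_sum_of_subset_of_nonneg (Finset.filter_subset _ _)
          fun p _ _ => by positivity
    _ = 2 ^ S.card * ((2 * price Φ) ^ S.card *
          ∑ U ∈ (vblSet Φ S).powerset, (1 / (k : ℝ)) ^ U.card) := by
        rw [Finset.sum_product]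
        simp only
        rw [Finset.sum_const, Finset.card_powerset, nsmul_eq_mul, ← Finset.mul_sum]
        push_cast
        ring
    _ ≤ 2 ^ S.card * ((2 * price Φ) ^ S.card * 3 ^ S.card) := by
        gcongr
        exact sum_inv_pow_card_le hk0 S
    _ = (12 * price Φ) ^ S.card := by
        rw [← mul_pow, ← mul_pow]; congr 1; ring

theorem card_connectedSets_le {c : ℝ} (h : IsNice c Φ ξ) {L : ℝ} {l : ℕ} (hl : 1 ≤ l) :
    (((connectedSets Φ L).filter fun S => S.card = l).card : ℝ) ≤
      m * (density Φ ^ 2 * (n : ℝ) ^ 4 * growth Φ ^ l) := by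
  have hsub : ((connectedSets Φ L).filter fun S => S.card = l) ⊆
      (Finset.univ : Finset (Fin m)).biUnion fun C => Finset.univ.filter fun S : Finset (Fin m) =>
        C ∈ S ∧ S.card = l ∧ ((clauseGraph Φ).induce (S : Set (Fin m))).Connected := by
    intro S hS
    obtain ⟨hS, hcard⟩ := Finset.mem_filter.1 hS
    have hconn := (Finset.mem_filter.1 hS).2.1
    obtain ⟨C, hC⟩ : S.Nonempty := Finset.card_pos.1 (by omega)
    rw [Finset.mem_biUnion]
    exact ⟨C, Finset.mem_univ _, Finset.mem_filter.2 ⟨Finset.mem_univ _, hC, hcard, hconn⟩⟩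
  have h1 := (Finset.card_le_card hsub).trans Finset.card_biUnion_le
  calc (((connectedSets Φ L).filter fun S => S.card = l).card : ℝ) ≤ _ := Nat.cast_le.2 h1
    _ ≤ ∑ _C : Fin m, density Φ ^ 2 * (n : ℝ) ^ 4 * growth Φ ^ l := by
        rw [Nat.cast_sum]
        exact Finset.sum_le_sum fun C _ => h.connected_count C l hl
    _ = m * (density Φ ^ 2 * (n : ℝ) ^ 4 * growth Φ ^ l) := by
        rw [Finset.sum_const, Finset.card_univ, Fintype.card_fin, nsmul_eq_mul]

theorem sum_witnesses_le {c : ℝ} (h : IsNice c Φ ξ) {L : ℝ} (hL : 0 ≤ L) :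
    ∑ W ∈ witnesses Φ ξ L, witnessWeight Φ (delta Φ ξ) W.2.1 W.2.2 ≤
      (m + 1) * (m * (density Φ ^ 2 * (n : ℝ) ^ 4)) * (k : ℝ) ^ (-L) := by
  have hk := h.k_pos
  have hk20 := h.k_ge
  have hα := h.density_pos
  have hz := h.price_pos
  have hΓ := h.growth_pos
  have hfib : ∀ l ∈ Finset.range (m + 1),
      ∑ S ∈ (connectedSets Φ L).filter (fun S => S.card = l), (12 * price Φ) ^ S.card ≤
        m * (density Φ ^ 2 * (n : ℝ) ^ 4) * (k : ℝ) ^ (-L) := by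
    intro l _
    by_cases hl : L < (l : ℝ)
    · have hl1 : 1 ≤ l := by
        have : (0 : ℝ) < l := lt_of_le_of_lt hL hl
        exact_mod_cast this
      have hsum : ∑ S ∈ (connectedSets Φ L).filter (fun S => S.card = l),
          (12 * price Φ) ^ S.card =
            ((connectedSets Φ L).filter fun S => S.card = l).card * (12 * price Φ) ^ l := by
        rw [Finset.sum_congr rfl fun S hS => by rw [(Finset.mem_filter.1 hS).2],
          Finset.sum_const, nsmul_eq_mul]
      rw [hsum]
      -- Here 12 = 2·2·3: the separator loss, the choice of `A`, and the choice of `U`. The product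
      -- of `price` and `growth` is exactly k⁻³⁰.
      have hzΓ : 12 * price Φ * growth Φ ≤ 1 / k := by
        unfold price
        rw [mul_one_div, div_mul_eq_mul_div, div_le_div_iff₀ (by positivity) hk]
        calc 12 * growth Φ * (k : ℝ) = growth Φ * (12 * k) := by ring
          _ ≤ growth Φ * (k ^ 29 * k) := by
              gcongr
              calc (12 : ℝ) ≤ (2 ^ 20) ^ 29 := by norm_num
                _ ≤ (k : ℝ) ^ 29 := by gcongr
          _ = 1 * (k ^ 30 * growth Φ) := by ring
      calc (((connectedSets Φ L).filter fun S => S.card = l).card : ℝ) * (12 * price Φ) ^ l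
          ≤ (m * (density Φ ^ 2 * (n : ℝ) ^ 4 * growth Φ ^ l)) * (12 * price Φ) ^ l := by
            gcongr
            exact h.card_connectedSets_le hl1
        _ = m * (density Φ ^ 2 * (n : ℝ) ^ 4) * (12 * price Φ * growth Φ) ^ l := by
            rw [mul_pow _ (growth Φ)]; ring
        _ ≤ m * (density Φ ^ 2 * (n : ℝ) ^ 4) * (1 / k) ^ l := by gcongr
        _ ≤ m * (density Φ ^ 2 * (n : ℝ) ^ 4) * (k : ℝ) ^ (-L) := by
            gcongr
            rw [one_div, inv_pow, ← Real.rpow_natCast, ← Real.rpow_neg hk.le]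
            exact Real.rpow_le_rpow_of_exponent_le (by linarith) (by linarith)
    · have hempty : (connectedSets Φ L).filter (fun S => S.card = l) = ∅ := by
        rw [Finset.filter_eq_empty_iff]
        rintro S hS rfl
        exact hl (Finset.mem_filter.1 hS).2.2
      rw [hempty, Finset.sum_empty]
      positivity
  calc ∑ W ∈ witnesses Φ ξ L, witnessWeight Φ (delta Φ ξ) W.2.1 W.2.2
      = ∑ S ∈ connectedSets Φ L, ∑ p ∈ splittings Φ ξ S, witnessWeight Φ (delta Φ ξ) p.1 p.2 :=
        Finset.sum_sigma _ _ _
    _ ≤ ∑ S ∈ connectedSets Φ L, (12 * price Φ) ^ S.card :=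
        Finset.sum_le_sum fun S _ => h.sum_splittings_le S
    _ = ∑ l ∈ Finset.range (m + 1), ∑ S ∈ (connectedSets Φ L).filter (fun S => S.card = l),
          (12 * price Φ) ^ S.card := by
        refine (Finset.sum_fiberwise_of_maps_to (fun S _ => ?_) _).symm
        have := Finset.card_le_univ S
        rw [Fintype.card_fin] at this
        exact Finset.mem_range.2 (by omega)
    _ ≤ ∑ _l ∈ Finset.range (m + 1), m * (density Φ ^ 2 * (n : ℝ) ^ 4) * (k : ℝ) ^ (-L) :=
        Finset.sum_le_sum hfib
    _ = (m + 1) * (m * (density Φ ^ 2 * (n : ℝ) ^ 4)) * (k : ℝ) ^ (-L) := by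
        rw [Finset.sum_const, Finset.card_range, nsmul_eq_mul]
        push_cast
        ring

theorem density_pow_le (h : IsNice 1 Φ ξ) : density Φ ^ 4 ≤ (n : ℝ) ^ 2 := by
  have hα := h.density_pos
  have hk20 := h.k_ge
  have h1 : density Φ ≤ (2 : ℝ) ^ ((k : ℝ) / 3) := by
    refine le_trans ?_ h.density_le
    exact le_mul_of_one_le_right hα.le (one_le_pow₀ (by linarith))
  have h2 : density Φ ^ 2 ≤ n := by
    calc density Φ ^ 2 ≤ ((2 : ℝ) ^ ((k : ℝ) / 3)) ^ 2 := by gcongr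
      _ = (2 : ℝ) ^ ((k : ℝ) / 3 * (2 : ℕ)) := by
          rw [Real.rpow_mul (by norm_num), Real.rpow_natCast]
      _ ≤ (2 : ℝ) ^ (k : ℝ) := by
          refine Real.rpow_le_rpow_of_exponent_le (by norm_num) ?_
          push_cast
          linarith
      _ ≤ n := by rw [Real.rpow_natCast]; exact h.two_pow_le
  calc density Φ ^ 4 = (density Φ ^ 2) ^ 2 := by ring
    _ ≤ (n : ℝ) ^ 2 := by gcongr

/-- With m = αn the left side is at most 4α⁴n⁷, and α² ≤ 2^(2k/3) ≤ n. -/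
theorem polynomial_factor_le (h : IsNice 1 Φ ξ) :
    ((n : ℝ) + 1) * ((m + 1) * (m * (density Φ ^ 2 * (n : ℝ) ^ 4))) ≤ (n : ℝ) ^ 10 := by
  have hn := h.n_pos
  have hα := h.density_pos
  have hm : (m : ℝ) = density Φ * n := by unfold density; field_simp
  have hm1 : (1 : ℝ) ≤ m := by
    have : (0 : ℝ) < m := by rw [hm]; positivity
    exact_mod_cast this
  have hn4 : (4 : ℝ) ≤ n := by
    refine le_trans ?_ h.two_pow_le
    calc (4 : ℝ) = 2 ^ 2 := by norm_num
      _ ≤ 2 ^ k := pow_le_pow_right₀ (by norm_num) (by have := h.k_large; omega)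
  calc ((n : ℝ) + 1) * ((m + 1) * (m * (density Φ ^ 2 * (n : ℝ) ^ 4)))
      ≤ (2 * n) * ((2 * m) * (m * (density Φ ^ 2 * (n : ℝ) ^ 4))) := by
        gcongr <;> linarith
    _ = 4 * density Φ ^ 4 * (n : ℝ) ^ 7 := by rw [hm]; ring
    _ ≤ n * (n : ℝ) ^ 2 * n ^ 7 := by
        gcongr
        exact h.density_pow_le
    _ = (n : ℝ) ^ 10 := by ring

/-- An explored set of clauses provides a witness of large potential. -/
theorem one_le_sum_of_explored (h : IsNice 1 Φ ξ) {L : ℝ} (hL : 0 ≤ L)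
    (hlog : Real.logb 2 n ≤ L) {σ : PAssign n} {S : Finset (Fin m)} {U : Finset (Fin n)}
    (hS : Explored Φ ξ σ S U) (hLS : L < (S.card : ℝ))
    (hcard : (S.card : ℝ) ≤ n / expScale k ^ 2) :
    1 ≤ ∑ W ∈ witnesses Φ ξ L, witnessWeight Φ (delta Φ ξ) W.2.1 W.2.2 *
      witnessPotential Φ (delta Φ ξ) W.2.1 W.2.2 σ := by
  have hδ := h.delta_pos
  have hδ2 := h.delta_le_half
  have hne : S.Nonempty := by
    rw [← Finset.card_pos]
    have : (0 : ℝ) < S.card := lt_of_le_of_lt hL hLS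
    exact_mod_cast this
  have hsplit : (S ∩ (frozen Φ ξ σ ∪ bad Φ ξ σ)).card + U.card + (S ∩ Csep Φ ξ).card = S.card := by
    have h1 : (S ∩ blocked Φ ξ σ).card =
        (S ∩ (frozen Φ ξ σ ∪ bad Φ ξ σ)).card + (S ∩ Csep Φ ξ).card := by
      rw [blocked, Finset.inter_union_distrib_left, Finset.card_union_of_disjoint]
      refine Finset.disjoint_of_subset_left Finset.inter_subset_right
        (Finset.disjoint_of_subset_right Finset.inter_subset_right ?_)
      rw [Finset.disjoint_left]
      intro C hC
      rcases Finset.mem_union.1 hC with hC | hC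
      · exact frozen_not_sep hC
      · exact bad_not_sep hC
    have h2 := Finset.card_sdiff_add_card_inter S (blocked Φ ξ σ)
    rw [hS.card_stars]
    omega
  have hmem : (⟨S, S ∩ (frozen Φ ξ σ ∪ bad Φ ξ σ), U⟩ :
      Σ _ : Finset (Fin m), Finset (Fin m) × Finset (Fin n)) ∈ witnesses Φ ξ L := by
    rw [witnesses, Finset.mem_sigma]
    refine ⟨Finset.mem_filter.2 ⟨Finset.mem_univ _, hS.linked.connected hne, hLS⟩,
      Finset.mem_filter.2 ⟨?_, hsplit, h.sep_fraction hS (hlog.trans hLS.le) hcard⟩⟩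
    exact Finset.mem_product.2 ⟨Finset.mem_powerset.2 Finset.inter_subset_left,
      Finset.mem_powerset.2 hS.stars_subset⟩
  refine (h.one_le_weight_mul_potential hδ hδ2 hS hcard).trans ?_
  exact Finset.single_le_sum (f := fun W : Σ _ : Finset (Fin m), Finset (Fin m) × Finset (Fin n) =>
    witnessWeight Φ (delta Φ ξ) W.2.1 W.2.2 * witnessPotential Φ (delta Φ ξ) W.2.1 W.2.2 σ)
    (fun W _ => mul_nonneg (witnessWeight_nonneg hδ)
      ((isPotential_witnessPotential hδ (by linarith)).nonneg σ)) hmem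

/-- The truncation probability of the sampler. -/
theorem pHalt_le (h : IsNice 1 Φ ξ) (hs : 6 * (k : ℝ) ^ 4 * density Φ * Real.logb 2 n < s)
    (hs' : s ≤ n / expScale k ^ 5) :
    pHalt Φ ξ s ≤ (n : ℝ) ^ 10 * (1 + delta Φ ξ) ^ (recDepth Φ ξ s + 1) *
      (k : ℝ) ^ (-(s / (6 * (k : ℝ) ^ 4 * density Φ))) := by
  have hk := h.k_pos
  have hα := h.density_pos
  have hδ := h.delta_pos
  have hδ2 := h.delta_le_half
  have hδ1 : delta Φ ξ ≤ 1 := by linarith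
  set L := s / (6 * (k : ℝ) ^ 4 * density Φ) with hLdef
  have hL : 0 ≤ L := by have := h.s_pos hs; positivity
  have hlog : Real.logb 2 n ≤ L := by
    rw [hLdef, le_div_iff₀ (by positivity)]
    linarith
  have hΨ : IsPotential (delta Φ ξ) fun π : PAssign n => ∑ W ∈ witnesses Φ ξ L,
      witnessWeight Φ (delta Φ ξ) W.2.1 W.2.2 *
        witnessPotential Φ (delta Φ ξ) W.2.1 W.2.2 π :=
    IsPotential.sum _ _ _ (fun W _ => witnessWeight_nonneg hδ)
      fun W _ => isPotential_witnessPotential hδ hδ1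
  have hmain := sampleLoop_halt_le (s := s) hδ.le hδ1 hΨ
    (fun σ v d π _ hst hπ hl => by
      obtain ⟨S, U, h1, h2, h3⟩ := h.explored_of_overflow hs hs' (v₀ := v) (by simp)
        (fun w hw => by
          by_contra hwv
          rw [Function.update_of_ne hwv] at hw
          exact hst w hw) hπ hl
      exact h.one_le_sum_of_explored hL hlog h1 h2 h3)
    (fun σ hσ hl => by
      obtain ⟨S, U, h1, h2, h3⟩ := h.explored_of_component hs hs' hσ.blocked_of_not_sat hl
      exact h.one_le_sum_of_explored hL hlog h1 h2 h3)
    (List.finRange n) _ h.loopState_init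
  simp only [witnessPotential_unaccessed, mul_one, List.length_finRange] at hmain
  rw [pHalt, solutionSampling_eq]
  refine hmain.trans ?_
  have hw := h.sum_witnesses_le hL
  have hpoly := h.polynomial_factor_le
  have hw0 : 0 ≤ ∑ W ∈ witnesses Φ ξ L, witnessWeight Φ (delta Φ ξ) W.2.1 W.2.2 :=
    Finset.sum_nonneg fun W _ => witnessWeight_nonneg hδ
  set P := (1 + delta Φ ξ) ^ recDepth Φ ξ s with hP
  have hP1 : 1 ≤ P := one_le_pow₀ (by linarith)
  have hP2 : P ≤ (1 + delta Φ ξ) ^ (recDepth Φ ξ s + 1) :=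
    pow_le_pow_right₀ (by linarith) (Nat.le_succ _)
  calc (n * P + 1) * ∑ W ∈ witnesses Φ ξ L, witnessWeight Φ (delta Φ ξ) W.2.1 W.2.2
      ≤ ((n + 1) * P) *
          ((m + 1) * (m * (density Φ ^ 2 * (n : ℝ) ^ 4)) * (k : ℝ) ^ (-L)) := by
        gcongr
        linarith
    _ = ((n + 1) * ((m + 1) * (m * (density Φ ^ 2 * (n : ℝ) ^ 4)))) * P * (k : ℝ) ^ (-L) := by
        ring
    _ ≤ (n : ℝ) ^ 10 * (1 + delta Φ ξ) ^ (recDepth Φ ξ s + 1) * (k : ℝ) ^ (-L) := by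
        gcongr

end IsNice

end RandomKSat

end

theorem lemma7p2 :
    ∃ c : ℝ, 0 < c ∧
      ∀ (k n m : ℕ) (Φ : RandomKSat.KCNF k n m) (ξ s : ℝ),
        RandomKSat.IsNice c Φ ξ →
        6 * (k : ℝ) ^ 4 * RandomKSat.density Φ * Real.logb 2 n < s →
        s ≤ n / (2 : ℝ) ^ (5 * (k : ℝ) / Real.logb 2 k) →
        RandomKSat.pHalt Φ ξ s ≤
          (n : ℝ) ^ 10 * (1 + RandomKSat.delta Φ ξ) ^ (RandomKSat.recDepth Φ ξ s + 1) *
            (k : ℝ) ^ (-(s / (6 * (k : ℝ) ^ 4 * RandomKSat.density Φ))) := by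
  refine ⟨1, one_pos, fun k n m Φ ξ s h hs hs' => h.pHalt_le hs ?_⟩
  have := RandomKSat.expScale_pow k 5
  push_cast at this
  rwa [this] at hs'
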